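/- Let $\theta\in\mathbb{R}^n$, let $C\in\mathbb{R}$ and $\beta>0$, and consider the system $y_k=\phi_k^\top\theta+d_k$, $k\ge 1$, with deterministic regressors $\phi_k\in\mathbb{R}^n$ and binary observations $s_k=I_{\{y_k\le C\}}$. Assume the following. (A1) $\sup_{k\ge1}\|\phi_k\|\le M<\infty$, and there are a positive integer $N\ge n$ and a real number $\delta>0$ with $\frac1N\sum_{i=k}^{k+N-1}\phi_i\phi_i^\top\ge\delta I_n$ for all $k\ge1$ (in the order of symmetric matrices). (A2) The noise $\{d_k,k\ge1\}$ is i.i.d. with zero mean and finite variance; its distribution function $F$ is Lipschitz continuous, and its density function $f$ satisfies $\inf_{x\in\mathfrak X}f(x)>0$ for every bounded open set $\mathfrak X\subset\mathbb{R}$. Let $\hat\theta_0$ be an arbitrary (possibly random) initial value, and for $k\ge1$ let $$\hat\theta_k=\hat\theta_{k-1}+\frac{\beta\phi_k}{k}\left(F(C-\phi_k^\top\hat\theta_{k-1})-s_k\right),\qquad T_k=\frac1k\sum_{i=1}^k\beta\phi_i\left(F(C-\phi_i^\top\theta)-s_i\right).$$ Let $\psi_k=(\hat\theta_k-\theta)-T_k$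 (the stochastic process with averaged observations, SPAO). Let $$\underline f=\lim_{z\to(M\|\theta\|)^+}\ \inf_{t\in[C-z,C+z]}f(t),\qquad \eta=\beta\delta\underline f .$$ Then, for every $\varepsilon>0$, almost surely as $k\to\infty$, $$\psi_k=\begin{cases}O\left(\sqrt{\frac{\ln\ln k}{k}}\right),&\eta>\frac12;\\ O\left(\frac1{k^{\eta-\varepsilon}}\right),&\eta\le\frac12.\end{cases}$$ If moreover $f$ is locally Lipschitz continuous, then almost surely as $k\to\infty$, $$\psi_k=\begin{cases}O\left(\sqrt{\frac{\ln\ln k}{k}}\right),&\eta>\frac12;\\ O\left(\ln k\sqrt{\frac{\ln\ln k}{k}}\right),&\eta=\frac12;\\ O\left(\frac1{k^{\eta}}\right),&\eta<\frac12.\end{cases}$$ -/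

import Mathlib

open Set Filter Topology MeasureTheory ProbabilityTheory Asymptotics

namespace SetValued

/-- Uniformly bounded, uniformly persistently exciting regressors `φ k`, `k ≥ 1`
(`φ 0` is not used): `‖φ k‖ ≤ M` and `(1/N) ∑_{i=k}^{k+N-1} φ i (φ i)ᵀ ≥ δ I_n` in the
Loewner order, where `N ≥ n` is a positive integer and `δ > 0`. -/
structure PersistentExcitation {n : ℕ} (φ : ℕ → EuclideanSpace ℝ (Fin n))
    (M δ : ℝ) (N : ℕ) : Prop where
  bounded : ∀ k, 1 ≤ k → ‖φ k‖ ≤ M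
  window_pos : 1 ≤ N
  window_ge : n ≤ N
  delta_pos : 0 < δ
  excitation : ∀ k, 1 ≤ k →
    ((1 / (N : ℝ)) • (∑ i ∈ Finset.Ico k (k + N), Matrix.vecMulVec (φ i).ofLp (φ i).ofLp)
      - δ • (1 : Matrix (Fin n) (Fin n) ℝ)).PosSemidef

/-- The distribution function `F` of the noise sequence `d k`, `k ≥ 1` (the law of `d 1`). -/
noncomputable def noiseCDF {Ω : Type*} [MeasurableSpace Ω] (μ : Measure Ω)
    (d : ℕ → Ω → ℝ) (x : ℝ) : ℝ :=
  cdf (μ.map (d 1)) x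

/-- The noise `d k`, `k ≥ 1` (`d 0` is not used): i.i.d., zero mean, finite variance, Lipschitz
distribution function, and a density function `f` which has a positive infimum on every bounded
open set. -/
structure NoiseAssumption {Ω : Type*} [MeasurableSpace Ω] (μ : Measure Ω)
    (d : ℕ → Ω → ℝ) (f : ℝ → ℝ) : Prop where
  indep : iIndepFun (fun k : ℕ => d (k + 1)) μ
  identDistrib : ∀ k, 1 ≤ k → IdentDistrib (d k) (d 1) μ μ
  memLp_two : MemLp (d 1) 2 μ
  mean_zero : ∫ ω, d 1 ω ∂μ = 0
  cdf_lipschitz : ∃ K, LipschitzWith K (noiseCDF μ d)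
  density_aemeasurable : AEMeasurable f volume
  density : μ.map (d 1) = volume.withDensity (fun x => ENNReal.ofReal (f x))
  density_pos : ∀ X : Set ℝ, IsOpen X → Bornology.IsBounded X → ∃ c > 0, ∀ x ∈ X, c ≤ f x

section System

variable {Ω : Type*} [MeasurableSpace Ω] {n : ℕ} (μ : Measure Ω)
  (d : ℕ → Ω → ℝ) (φ : ℕ → EuclideanSpace ℝ (Fin n)) (θ : EuclideanSpace ℝ (Fin n)) (C β : ℝ)
  (θ₀ : Ω → EuclideanSpace ℝ (Fin n))

/-- The unobserved output `y k = (φ k)ᵀ θ + d k`. -/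
noncomputable def output (k : ℕ) (ω : Ω) : ℝ :=
  inner ℝ (φ k) θ + d k ω

open Classical in
/-- The binary observation `s k = I_{y k ≤ C}`. -/
noncomputable def observation (k : ℕ) (ω : Ω) : ℝ :=
  if output d φ θ k ω ≤ C then 1 else 0

/-- The stochastic approximation estimates started at `θ₀`: for `k ≥ 1`,
`θhat k = θhat (k-1) + (β φ k / k) (F (C - (φ k)ᵀ θhat (k-1)) - s k)`. -/
noncomputable def estimate : ℕ → Ω → EuclideanSpace ℝ (Fin n)
  | 0, ω => θ₀ ω
  | k + 1, ω =>
    estimate k ω +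
      (β / ((k + 1 : ℕ) : ℝ) *
        (noiseCDF μ d (C - inner ℝ (φ (k + 1)) (estimate k ω))
          - observation d φ θ C (k + 1) ω)) • φ (k + 1)

/-- `T k = (∑_{i=1}^k β φ i (F i - s i)) / k`, with `F i = F (C - (φ i)ᵀ θ)`. -/
noncomputable def averagedNoise (k : ℕ) (ω : Ω) : EuclideanSpace ℝ (Fin n) :=
  (1 / (k : ℝ)) • ∑ i ∈ Finset.Icc 1 k,
    (β * (noiseCDF μ d (C - inner ℝ (φ i) θ) - observation d φ θ C i ω)) • φ i

/-- The stochastic process with averaged observations: `ψ k = (θhat k - θ) - T k`. -/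
noncomputable def spao (k : ℕ) (ω : Ω) : EuclideanSpace ℝ (Fin n) :=
  (estimate μ d φ θ C β θ₀ k ω - θ) - averagedNoise μ d φ θ C β k ω

end System

/-- The right limit, as `z ↓ M ‖θ‖ + x`, of `inf_{t ∈ [C - z, C + z]} f t`. -/
noncomputable def lowerDensity {n : ℕ} (f : ℝ → ℝ) (C M : ℝ) (θ : EuclideanSpace ℝ (Fin n))
    (x : ℝ) : ℝ :=
  Function.rightLim (fun z : ℝ => sInf (f '' Icc (C - z) (C + z))) (M * ‖θ‖ + x)

/-- The limit in the definition of `lowerDensity` exists. -/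
theorem tendsto_lowerDensity {n : ℕ} {f : ℝ → ℝ} (hf : ∀ t, 0 ≤ f t) (C : ℝ) {M : ℝ}
    (hM : 0 ≤ M) (θ : EuclideanSpace ℝ (Fin n)) {x : ℝ} (hx : 0 ≤ x) :
    Tendsto (fun z : ℝ => sInf (f '' Icc (C - z) (C + z))) (𝓝[>] (M * ‖θ‖ + x))
      (𝓝 (lowerDensity f C M θ x)) := by
  have hr : 0 ≤ M * ‖θ‖ + x := by positivity
  set r := M * ‖θ‖ + x with hrdef
  set G : ℝ → ℝ := fun z => sInf (f '' Icc (C - z) (C + z)) with hG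
  have hbdd : ∀ z, BddBelow (f '' Icc (C - z) (C + z)) := fun z =>
    ⟨0, by rintro _ ⟨t, -, rfl⟩; exact hf t⟩
  have hanti : ∀ a b : ℝ, 0 ≤ a → a ≤ b → G b ≤ G a := fun a b ha hab =>
    csInf_le_csInf (hbdd b) ⟨f C, C, ⟨by linarith, by linarith⟩, rfl⟩
      (image_mono (Icc_subset_Icc (by linarith) (by linarith)))
  have hanti' : Antitone (fun z => G (max z 0)) := fun a b hab =>
    hanti _ _ (le_max_right _ _) (max_le_max_right _ hab)
  have heq : (fun z => G (max z 0)) =ᶠ[𝓝[>] r] G := by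
    filter_upwards [self_mem_nhdsWithin] with z hz
    rw [max_eq_left (hr.trans (le_of_lt hz))]
  have ht : Tendsto G (𝓝[>] r) (𝓝 (Function.rightLim (fun z => G (max z 0)) r)) :=
    (hanti'.tendsto_rightLim r).congr' heq
  have : lowerDensity f C M θ x = Function.rightLim (fun z => G (max z 0)) r :=
    rightLim_eq_of_tendsto ht
  rw [this]
  exact ht

end SetValued

/-!
Averaging the observations moves the noise into a small forcing term: `ψ` obeys the linear recursion
`ψ (k+1) = ψ k + (T k - a k ⟪φ (k+1), ψ k + T k⟫ φ (k+1)) / (k+1)`, where the gain `a k` is `β`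
times the secant slope of `F` between its arguments at `θ` and at the estimate. The law of the
iterated logarithm bound `T k = O(√(log log k / k))` holds almost surely, by Hoeffding's lemma and a
maximal inequality along dyadic blocks, and everything after it is pathwise.

Over a window of `N` steps, persistent excitation contracts `ψ` by the factor `1 - N δ α m / m`,
where `α m` is a lower bound of the gains in the window, so a sequence which decays more slowly than
this and absorbs the forcing is a supersolution. As the estimate grows at most like `log k`, the
gains are at least of order `1 / log k`, which is enough for consistency. Once the estimate is close
to `θ`, every `β c` with `c < f̲` is eventually a lower bound of the gains, which gives the rates up
to `ε`; fed back into the recursion, these rates bound the gains below by `β f̲ - O(k ^ (-γ))` when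
`f` is locally Lipschitz, and that error is summable against `1 / k`.
-/

namespace SetValued

section SubgaussianSums

variable {Ω : Type*} {mΩ : MeasurableSpace Ω} {μ : Measure Ω}

theorem submartingale_convexOn_comp {ι E : Type*} [Preorder ι] [NormedAddCommGroup E]
    [NormedSpace ℝ E] [FiniteDimensional ℝ E] {ℱ : Filtration ι mΩ} [SigmaFiniteFiltration μ ℱ]
    {S : ι → Ω → E} {g : E → ℝ} (hS : Martingale S ℱ μ) (hg : ConvexOn ℝ univ g)
    (hint : ∀ i, Integrable (g ∘ S i) μ) : Submartingale (fun i => g ∘ S i) ℱ μ := by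
  have hcont : Continuous g := continuousOn_univ.1 (hg.continuousOn isOpen_univ)
  refine ⟨fun i => hcont.comp_stronglyMeasurable (hS.1 i), fun i j hij => ?_, hint⟩
  filter_upwards [hg.map_condExp_le_of_finiteDimensional (ℱ.le i) (hS.integrable j) (hint j),
    hS.2 i j hij] with ω hjensen hcond
  simpa only [Function.comp_apply, hcond] using hjensen

theorem martingale_sum_range_succ {E : Type*} [NormedAddCommGroup E] [NormedSpace ℝ E]
    [CompleteSpace E] [MeasurableSpace E] [BorelSpace E] [SecondCountableTopology E]
    {X : ℕ → Ω → E} (hX : ∀ i, StronglyMeasurable (X i)) (hind : iIndepFun X μ)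
    (hint : ∀ i, Integrable (X i) μ) (hmean : ∀ i, ∫ ω, X i ω ∂μ = 0) :
    Martingale (fun n => ∑ i ∈ Finset.range (n + 1), X i) (Filtration.natural X hX) μ := by
  have := hind.isProbabilityMeasure
  have hadapted : ∀ n, StronglyMeasurable[Filtration.natural X hX n]
      (∑ i ∈ Finset.range (n + 1), X i) := fun n =>
    Finset.stronglyMeasurable_sum _ fun i hi =>
      (Filtration.stronglyAdapted_natural hX i).mono
        ((Filtration.natural X hX).mono (Finset.mem_range_succ_iff.1 hi))
  have hsum : ∀ n, Integrable (∑ i ∈ Finset.range (n + 1), X i) μ := fun n =>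
    integrable_finsetSum' _ fun i _ => hint i
  refine martingale_nat hadapted hsum fun n => ?_
  rw [Finset.sum_range_succ _ (n + 1)]
  refine EventuallyEq.symm ((condExp_add (hsum n) (hint (n + 1)) _).trans ?_)
  rw [condExp_of_stronglyMeasurable ((Filtration.natural X hX).le n) (hadapted n) (hsum n)]
  filter_upwards [iIndepFun.condExp_natural_ae_eq_of_lt hX hind n.lt_succ_self] with ω hω
  simp [hω, hmean]

theorem integral_eq_zero_of_hasSubgaussianMGF [IsProbabilityMeasure μ] {X : Ω → ℝ} {c : NNReal}
    (hX : HasSubgaussianMGF X c μ) : ∫ ω, X ω ∂μ = 0 := by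
  have hquad : ∀ t : ℝ, t * ∫ ω, X ω ∂μ ≤ c * t ^ 2 / 2 := fun t => by
    have hjensen := convexOn_exp.map_integral_le (f := fun ω => t * X ω)
      Real.continuous_exp.continuousOn isClosed_univ (ae_of_all μ fun _ => mem_univ _)
      (hX.integrable.const_mul t) (hX.integrable_exp_mul t)
    rw [integral_const_mul] at hjensen
    exact Real.exp_le_exp.1 (hjensen.trans (hX.mgf_le t))
  set m := ∫ ω, X ω ∂μ
  have h := hquad (m / (c + 1))
  have hc : (0 : ℝ) < c + 1 := by positivity
  rw [div_pow] at h
  field_simp at h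
  nlinarith [sq_nonneg m, c.coe_nonneg]

theorem measure_exists_le_le_integral_div [IsFiniteMeasure μ] {ℱ : Filtration ℕ mΩ}
    {Y : ℕ → Ω → ℝ} (hY : Submartingale Y ℱ μ) (hY0 : 0 ≤ Y) (n : ℕ) {y : ℝ} (hy : 0 < y) :
    μ {ω | ∃ k ≤ n, y ≤ Y k ω} ≤ ENNReal.ofReal ((∫ ω, Y n ω ∂μ) / y) := by
  have hdoob := maximal_ineq hY hY0 (ε := y.toNNReal) n
  simp only [Real.coe_toNNReal y hy.le, Finset.le_sup'_iff, Finset.mem_range_succ_iff] at hdoob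
  rw [ENNReal.ofReal_div_of_pos hy, ENNReal.le_div_iff_mul_le (by simp [hy]) (by simp), mul_comm]
  exact hdoob.trans (ENNReal.ofReal_le_ofReal
    (setIntegral_le_integral (hY.integrable n) (ae_of_all _ (hY0 n))))

theorem measure_exists_le_sum_le {X : ℕ → Ω → ℝ} {c : ℕ → NNReal}
    (hX : ∀ i, StronglyMeasurable (X i)) (hind : iIndepFun X μ)
    (hsub : ∀ i, HasSubgaussianMGF (X i) (c i) μ) (n : ℕ) {x : ℝ} (hx : 0 ≤ x) :
    μ {ω | ∃ k ≤ n, x ≤ ∑ i ∈ Finset.range (k + 1), X i ω} ≤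
      ENNReal.ofReal (Real.exp (-x ^ 2 / (2 * ∑ i ∈ Finset.range (n + 1), (c i : ℝ)))) := by
  have := hind.isProbabilityMeasure
  set v : ℝ := ∑ i ∈ Finset.range (n + 1), (c i : ℝ)
  set t : ℝ := x / v with ht
  have ht0 : 0 ≤ t := by positivity
  have hsubS : ∀ k, HasSubgaussianMGF (∑ i ∈ Finset.range (k + 1), X i)
      (∑ i ∈ Finset.range (k + 1), c i) μ := fun k => by
    simpa only [← Finset.sum_fn] using
      HasSubgaussianMGF.sum_of_iIndepFun hind (s := Finset.range (k + 1)) fun i _ => hsub i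
  have hconv : ConvexOn ℝ univ fun s : ℝ => Real.exp (t * s) :=
    convexOn_exp.comp_linearMap (LinearMap.lsmul ℝ ℝ t)
  have hexp := submartingale_convexOn_comp
    (martingale_sum_range_succ hX hind (fun i => (hsub i).integrable)
      fun i => integral_eq_zero_of_hasSubgaussianMGF (hsub i)) hconv
    fun k => (hsubS k).integrable_exp_mul t
  calc μ {ω | ∃ k ≤ n, x ≤ ∑ i ∈ Finset.range (k + 1), X i ω}
      ≤ μ {ω | ∃ k ≤ n, Real.exp (t * x) ≤ Real.exp (t * (∑ i ∈ Finset.range (k + 1), X i) ω)} := by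
        refine measure_mono fun ω ⟨k, hk, hxk⟩ => ⟨k, hk, ?_⟩
        rw [Finset.sum_apply]
        gcongr
    _ ≤ ENNReal.ofReal ((∫ ω, Real.exp (t * (∑ i ∈ Finset.range (n + 1), X i) ω) ∂μ)
          / Real.exp (t * x)) :=
        measure_exists_le_le_integral_div hexp (fun k ω => (Real.exp_pos _).le) n (Real.exp_pos _)
    _ ≤ ENNReal.ofReal (Real.exp (v * t ^ 2 / 2) / Real.exp (t * x)) := by
        gcongr
        refine ((hsubS n).mgf_le t).trans_eq ?_
        rw [NNReal.coe_sum]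
    _ = ENNReal.ofReal (Real.exp (-x ^ 2 / (2 * v))) := by
        rw [← Real.exp_sub, ht]
        rcases eq_or_ne v 0 with hv0 | hv0
        · simp [hv0]
        · congr 2
          field_simp
          ring

theorem ae_eventually_forall_sum_lt {X : ℕ → Ω → ℝ} {c : NNReal}
    (hX : ∀ i, StronglyMeasurable (X i)) (hind : iIndepFun X μ) (hc : 0 < c)
    (hsub : ∀ i, HasSubgaussianMGF (X i) c μ) :
    ∀ᵐ ω ∂μ, ∀ᶠ j : ℕ in atTop, ∀ k < 2 ^ j,
      ∑ i ∈ Finset.range (k + 1), X i ω < 2 * √(c * 2 ^ j * Real.log j) := by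
  have := hind.isProbabilityMeasure
  set s : ℕ → Set Ω := fun j => {ω | ∃ k ≤ 2 ^ j - 1,
    2 * √(c * 2 ^ j * Real.log j) ≤ ∑ i ∈ Finset.range (k + 1), X i ω}
  have hle : ∀ j, μ (s (j + 1)) ≤ ENNReal.ofReal (1 / ((j + 1 : ℕ) : ℝ) ^ 2) := fun j => by
    have hlog : 0 ≤ Real.log ((j + 1 : ℕ) : ℝ) := Real.log_natCast_nonneg _
    refine (measure_exists_le_sum_le hX hind hsub (2 ^ (j + 1) - 1) (by positivity)).trans_eq ?_
    rw [Nat.sub_add_cancel Nat.one_le_two_pow, Finset.sum_const, Finset.card_range, nsmul_eq_mul,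
      mul_pow, Real.sq_sqrt (by positivity), Nat.cast_pow, Nat.cast_two]
    have hexp : -(2 ^ 2 * (c * 2 ^ (j + 1) * Real.log ((j + 1 : ℕ) : ℝ))) / (2 * (2 ^ (j + 1) * c))
        = -(((2 : ℕ) : ℝ) * Real.log ((j + 1 : ℕ) : ℝ)) := by
      push_cast
      field_simp
    rw [hexp, ← Real.log_pow, Real.exp_neg, Real.exp_log (by positivity), one_div]
  have hsum : ∑' j, μ (s (j + 1)) ≠ ⊤ :=
    ne_top_of_le_ne_top ((summable_nat_add_iff 1).2
      (Real.summable_one_div_nat_pow.2 one_lt_two)).tsum_ofReal_ne_top (ENNReal.tsum_le_tsum hle)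
  filter_upwards [ae_eventually_notMem hsum] with ω hω
  rw [← map_add_atTop_eq_nat 1, eventually_map]
  filter_upwards [hω] with j hj k hk
  by_contra! hge
  exact hj ⟨k, Nat.le_sub_one_of_lt hk, hge⟩

theorem eventually_two_pow_log_mul_log_le : ∀ᶠ k : ℕ in atTop,
    2 ^ (Nat.log 2 k + 1) * Real.log (Nat.log 2 k + 1 : ℕ) ≤ 4 * (k * Real.log (Real.log k)) := by
  filter_upwards [eventually_ge_atTop 1,
    (Real.tendsto_log_atTop.comp tendsto_natCast_atTop_atTop).eventually_ge_atTop (3 : ℝ)]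
    with k hk hlogk
  rw [Function.comp_apply] at hlogk
  have hpow : (2 : ℝ) ^ Nat.log 2 k ≤ k := by
    exact_mod_cast Nat.pow_log_le_self 2 (Nat.one_le_iff_ne_zero.1 hk)
  have hlog : (Nat.log 2 k : ℝ) * Real.log 2 ≤ Real.log k := by
    rw [← Real.log_pow]
    exact Real.log_le_log (by positivity) hpow
  have hsq : ((Nat.log 2 k + 1 : ℕ) : ℝ) ≤ Real.log k ^ 2 := by
    push_cast
    nlinarith [Real.log_two_gt_d9, (Nat.log 2 k).cast_nonneg (α := ℝ)]
  have hloglog : Real.log (Nat.log 2 k + 1 : ℕ) ≤ 2 * Real.log (Real.log k) := by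
    simpa only [Real.log_pow, Nat.cast_ofNat] using Real.log_le_log (by positivity) hsq
  calc (2 : ℝ) ^ (Nat.log 2 k + 1) * Real.log (Nat.log 2 k + 1 : ℕ)
      ≤ (2 * k) * (2 * Real.log (Real.log k)) := by
        rw [pow_succ']
        gcongr
    _ = 4 * (k * Real.log (Real.log k)) := by ring

theorem ae_eventually_sum_le {X : ℕ → Ω → ℝ} {c : NNReal}
    (hX : ∀ i, StronglyMeasurable (X i)) (hind : iIndepFun X μ) (hc : 0 < c)
    (hsub : ∀ i, HasSubgaussianMGF (X i) c μ) :
    ∀ᵐ ω ∂μ, ∀ᶠ k : ℕ in atTop,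
      ∑ i ∈ Finset.range k, X i ω ≤ 4 * √c * √(k * Real.log (Real.log k)) := by
  have hblock : Tendsto (fun k => Nat.log 2 k + 1) atTop atTop :=
    (tendsto_add_atTop_nat 1).comp (tendsto_atTop.2 fun b =>
      (eventually_ge_atTop (2 ^ b)).mono fun _ => Nat.le_log_of_pow_le one_lt_two)
  filter_upwards [ae_eventually_forall_sum_lt hX hind hc hsub] with ω hω
  filter_upwards [hblock.eventually hω, eventually_two_pow_log_mul_log_le, eventually_ge_atTop 1]
    with k hlt hle hk
  have hk' : k - 1 + 1 = k := Nat.sub_add_cancel hk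
  calc ∑ i ∈ Finset.range k, X i ω
      ≤ 2 * √(c * 2 ^ (Nat.log 2 k + 1) * Real.log (Nat.log 2 k + 1 : ℕ)) := by
        have hlast := hlt (k - 1) ((Nat.sub_lt hk one_pos).trans
          (Nat.lt_pow_succ_log_self one_lt_two k))
        rw [hk'] at hlast
        exact hlast.le
    _ ≤ 2 * √(2 ^ 2 * (c * (k * Real.log (Real.log k)))) := by
        gcongr 2 * √?_
        nlinarith [mul_le_mul_of_nonneg_left hle c.coe_nonneg]
    _ = 4 * √c * √(k * Real.log (Real.log k)) := by
        rw [Real.sqrt_mul (by positivity), Real.sqrt_sq zero_le_two, Real.sqrt_mul c.coe_nonneg]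
        ring

/-- The upper half of the law of the iterated logarithm, up to the constant. -/
theorem ae_sum_isBigO_sqrt_log_log {X : ℕ → Ω → ℝ} {c : NNReal} (hind : iIndepFun X μ) (hc : 0 < c)
    (hsub : ∀ i, HasSubgaussianMGF (X i) c μ) :
    ∀ᵐ ω ∂μ, (fun k : ℕ => ∑ i ∈ Finset.range k, X i ω) =O[atTop]
      fun k : ℕ => √(k * Real.log (Real.log k)) := by
  have hae : ∀ i, X i =ᵐ[μ] (hsub i).aestronglyMeasurable.mk (X i) := fun i =>
    (hsub i).aestronglyMeasurable.ae_eq_mk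
  set Y : ℕ → Ω → ℝ := fun i => (hsub i).aestronglyMeasurable.mk (X i)
  have hYm : ∀ i, StronglyMeasurable (Y i) := fun i => AEStronglyMeasurable.stronglyMeasurable_mk _
  have hY : ∀ i, HasSubgaussianMGF (Y i) c μ := fun i => (hsub i).congr (hae i)
  have hYind : iIndepFun Y μ := hind.congr hae
  filter_upwards [ae_all_iff.2 hae, ae_eventually_sum_le hYm hYind hc hY,
    ae_eventually_sum_le (X := fun i => -Y i) (fun i => (hYm i).neg)
      (hYind.comp (fun _ x => -x) fun _ => measurable_neg) hc fun i => (hY i).neg]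
    with ω heq hupper hlower
  refine IsBigO.of_bound (4 * √c) ?_
  filter_upwards [hupper, hlower] with k hk hk'
  simp only [Pi.neg_apply, Finset.sum_neg_distrib] at hk'
  rw [Real.norm_of_nonneg (Real.sqrt_nonneg _), Real.norm_eq_abs, abs_le,
    Finset.sum_congr rfl fun i _ => heq i]
  exact ⟨by linarith, hk⟩

end SubgaussianSums

section DecayRate

theorem log_add_sub_log_le {x y : ℝ} (hx : 0 < x) (hy : 0 ≤ y) :
    Real.log (x + y) - Real.log x ≤ y / x := by
  rw [← Real.log_div (by positivity) hx.ne']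
  refine (Real.log_le_sub_one_of_pos (by positivity)).trans_eq ?_
  field_simp
  ring

theorem div_le_log_add_sub_log {x y : ℝ} (hx : 0 < x) (hy : 0 ≤ y) (hyx : y ≤ x) :
    y / (2 * x) ≤ Real.log (x + y) - Real.log x := by
  rw [← Real.log_div (by positivity) hx.ne']
  calc y / (2 * x) ≤ y / (x + y) := by gcongr; linarith
    _ = 1 - ((x + y) / x)⁻¹ := by field_simp; ring
    _ ≤ Real.log ((x + y) / x) := Real.one_sub_inv_le_log_of_pos (by positivity)

theorem tendsto_log_natCast : Tendsto (fun m : ℕ => Real.log m) atTop atTop :=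
  Real.tendsto_log_atTop.comp tendsto_natCast_atTop_atTop

theorem eventually_pos_le_one_le_log (N : ℕ) :
    ∀ᶠ m : ℕ in atTop, (0 : ℝ) < m ∧ (N : ℝ) ≤ m ∧ 1 ≤ Real.log m := by
  filter_upwards [eventually_gt_atTop 0, eventually_ge_atTop N,
    tendsto_log_natCast.eventually_ge_atTop 1] with m hm hN hlog
  exact ⟨Nat.cast_pos.2 hm, Nat.cast_le.2 hN, hlog⟩

/-- The positive sequence `g` decays over a window of length `N` at most as fast as `m ^ (-σ m)`
does: to first order, `g (m + N) ≥ (1 - N σ m / m) g m`. The condition is put on `log g`, so that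
the rates of a product add up. -/
def HasDecayRate (N : ℕ) (g σ : ℕ → ℝ) : Prop :=
  ∀ᶠ m : ℕ in atTop, 0 < g m ∧ Real.log (g m) - Real.log (g (m + N)) ≤ N * σ m / m

namespace HasDecayRate

variable {N : ℕ} {g h σ τ : ℕ → ℝ}

theorem eventually_pos (hg : HasDecayRate N g σ) : ∀ᶠ m in atTop, 0 < g m := hg.mono fun _ h => h.1

theorem eventually_mul_le (hg : HasDecayRate N g σ) :
    ∀ᶠ m : ℕ in atTop, (1 - N * σ m / m) * g m ≤ g (m + N) := by
  filter_upwards [hg, (tendsto_add_atTop_nat N).eventually hg] with m ⟨hgm, hlog⟩ ⟨hgN, _⟩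
  have hexp := Real.one_sub_le_exp_neg (N * σ m / m)
  calc (1 - N * σ m / m) * g m ≤ Real.exp (-(N * σ m / m)) * g m := by gcongr
    _ ≤ Real.exp (Real.log (g (m + N)) - Real.log (g m)) * g m := by gcongr; linarith
    _ = g (m + N) := by
      rw [Real.exp_sub, Real.exp_log hgm, Real.exp_log hgN, div_mul_cancel₀ _ hgm.ne']

theorem mul (hg : HasDecayRate N g σ) (hh : HasDecayRate N h τ) :
    HasDecayRate N (fun m => g m * h m) fun m => σ m + τ m := by
  filter_upwards [hg, hh, (tendsto_add_atTop_nat N).eventually hg,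
    (tendsto_add_atTop_nat N).eventually hh] with m ⟨hgm, hgσ⟩ ⟨hhm, hhτ⟩ ⟨hgN, _⟩ ⟨hhN, _⟩
  refine ⟨mul_pos hgm hhm, ?_⟩
  rw [Real.log_mul hgm.ne' hhm.ne', Real.log_mul hgN.ne' hhN.ne', mul_add, add_div]
  linarith

theorem of_monotoneOn {a : ℕ} (hpos : ∀ᶠ m in atTop, 0 < g m) (hmono : MonotoneOn g (Ici a)) :
    HasDecayRate N g fun _ => 0 := by
  filter_upwards [hpos, eventually_ge_atTop a] with m hm ham
  have hlog := Real.log_le_log hm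
    (hmono (mem_Ici.2 ham) (mem_Ici.2 (ham.trans (Nat.le_add_right m N))) (Nat.le_add_right m N))
  exact ⟨hm, by simpa using hlog⟩

theorem rpow_neg {p : ℝ} (hp : 0 ≤ p) : HasDecayRate N (fun m => (m : ℝ) ^ (-p)) fun _ => p := by
  filter_upwards [eventually_gt_atTop 0] with m hm
  have hm0 : (0 : ℝ) < m := Nat.cast_pos.2 hm
  have hlog := mul_le_mul_of_nonneg_left (log_add_sub_log_le hm0 N.cast_nonneg) hp
  refine ⟨by positivity, ?_⟩
  rw [Real.log_rpow hm0, Real.log_rpow (by positivity), Nat.cast_add]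
  linarith [mul_div_right_comm (N : ℝ) p m, mul_div_assoc p (N : ℝ) m, mul_comm (N : ℝ) p]

theorem log : HasDecayRate N (fun m => Real.log m) fun m => -(1 / (4 * Real.log m)) := by
  filter_upwards [eventually_pos_le_one_le_log N] with m ⟨hm0, hNm, hlog⟩
  have hgap := div_le_log_add_sub_log hm0 N.cast_nonneg hNm
  have hle : (N : ℝ) / (2 * m) ≤ Real.log m :=
    (div_le_one_of_le₀ (by linarith) (by positivity)).trans hlog
  refine ⟨by linarith, ?_⟩
  calc Real.log (Real.log m) - Real.log (Real.log (m + N : ℕ))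
      ≤ Real.log (Real.log m) - Real.log (Real.log m + N / (2 * m)) := by
        push_cast
        gcongr
        linarith
    _ ≤ -(N / (2 * m) / (2 * Real.log m)) := by
        linarith [div_le_log_add_sub_log (by linarith : 0 < Real.log m)
          (by positivity : (0 : ℝ) ≤ N / (2 * m)) hle]
    _ = N * -(1 / (4 * Real.log m)) / m := by field_simp; norm_num

theorem log_rpow_neg {κ : ℝ} (hκ : 0 ≤ κ) :
    HasDecayRate N (fun m => Real.log m ^ (-κ)) fun m => κ / Real.log m := by
  filter_upwards [eventually_pos_le_one_le_log N] with m ⟨hm0, _, hlog⟩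
  have hlog0 : 0 < Real.log m := by linarith
  have hgap := log_add_sub_log_le hm0 N.cast_nonneg
  have hmono : Real.log m ≤ Real.log (m + N) :=
    Real.log_le_log hm0 (le_add_of_nonneg_right N.cast_nonneg)
  have hlog2 : Real.log (Real.log (m + N)) - Real.log (Real.log m) ≤ N / m / Real.log m := by
    have h := log_add_sub_log_le hlog0 (sub_nonneg.2 hmono)
    rw [add_sub_cancel] at h
    exact h.trans (by gcongr)
  refine ⟨by positivity, ?_⟩
  rw [Real.log_rpow hlog0, Nat.cast_add, Real.log_rpow (hlog0.trans_le hmono)]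
  calc -κ * Real.log (Real.log m) - -κ * Real.log (Real.log (m + N))
      = κ * (Real.log (Real.log (m + N)) - Real.log (Real.log m)) := by ring
    _ ≤ κ * (N / m / Real.log m) := by gcongr
    _ = N * (κ / Real.log m) / m := by ring

theorem exp_neg_inv_log : HasDecayRate N (fun m => Real.exp (-(Real.log m)⁻¹))
    fun m => -(1 / (4 * Real.log m ^ 2)) := by
  filter_upwards [eventually_pos_le_one_le_log N] with m ⟨hm0, hNm, hlog⟩
  have hlog0 : 0 < Real.log m := by linarith
  set b : ℝ := N / (2 * m) with hb
  have hb0 : 0 ≤ b := by positivity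
  have hgap : Real.log m + b ≤ Real.log (m + N) := by
    linarith [div_le_log_add_sub_log hm0 N.cast_nonneg hNm]
  have hle : b ≤ Real.log m := (div_le_one_of_le₀ (by linarith) (by positivity)).trans hlog
  refine ⟨Real.exp_pos _, ?_⟩
  rw [Real.log_exp, Real.log_exp, Nat.cast_add]
  calc -(Real.log m)⁻¹ - -(Real.log (m + N))⁻¹
      ≤ -(Real.log m)⁻¹ - -(Real.log m + b)⁻¹ := by gcongr
    _ = -(b / (Real.log m * (Real.log m + b))) := by field_simp; ring
    _ ≤ -(b / (Real.log m * (2 * Real.log m))) := by gcongr; linarith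
    _ = N * -(1 / (4 * Real.log m ^ 2)) / m := by rw [hb]; field_simp; norm_num

end HasDecayRate

/-- The scale `√(log log m / m)` of the law of the iterated logarithm. -/
noncomputable def lilScale (m : ℕ) : ℝ := √(Real.log (Real.log m) / m)

theorem lilScale_nonneg (m : ℕ) : 0 ≤ lilScale m := Real.sqrt_nonneg _

theorem lilScale_eq_mul_rpow (m : ℕ) :
    lilScale m = √(Real.log (Real.log m)) * (m : ℝ) ^ (-(1 / 2) : ℝ) := by
  rw [lilScale, Real.sqrt_div' _ m.cast_nonneg, Real.rpow_neg m.cast_nonneg, ← Real.sqrt_eq_rpow,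
    div_eq_mul_inv]

theorem hasDecayRate_lilScale (N : ℕ) : HasDecayRate N lilScale fun _ => 1 / 2 := by
  have hpos : ∀ᶠ m : ℕ in atTop, 0 < √(Real.log (Real.log m)) :=
    ((Real.tendsto_log_atTop.comp tendsto_log_natCast).eventually_gt_atTop 0).mono
      fun _ => Real.sqrt_pos.2
  have hmono : MonotoneOn (fun m : ℕ => √(Real.log (Real.log m))) (Ici 2) := fun a ha b _ hab => by
    have ha' : (1 : ℝ) < a := Nat.one_lt_cast.2 ha
    have := Real.log_pos ha'
    dsimp only
    gcongr
  simpa only [← lilScale_eq_mul_rpow, zero_add] using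
    (HasDecayRate.of_monotoneOn hpos hmono).mul (HasDecayRate.rpow_neg (p := 1 / 2) (by norm_num))

theorem eventually_lilScale_add_le : ∀ᶠ m : ℕ in atTop, ∀ i, lilScale (m + i) ≤ lilScale m := by
  filter_upwards [tendsto_natCast_atTop_atTop.eventually_ge_atTop (Real.exp 1),
    tendsto_log_natCast.eventually_ge_atTop (Real.exp 1)] with m hm hlog i
  have hmi : (m : ℝ) ≤ (m + i : ℕ) := by simp
  have hm0 : 0 < (m : ℝ) := (Real.exp_pos 1).trans_le hm
  have hlogmono := Real.log_le_log hm0 hmi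
  have hlog0 : 0 < Real.log m := (Real.exp_pos 1).trans_le hlog
  have hsplit : ∀ k : ℕ, 0 < Real.log k → Real.log (Real.log k) / (k : ℝ)
      = Real.log (Real.log k) / Real.log k * (Real.log k / k) := fun k hk => by field_simp
  refine Real.sqrt_le_sqrt ?_
  rw [hsplit _ hlog0, hsplit _ (hlog0.trans_le hlogmono)]
  have hloglog : 0 ≤ Real.log (Real.log m) :=
    Real.log_nonneg ((Real.one_lt_exp_iff.2 one_pos).le.trans hlog)
  exact mul_le_mul (Real.log_div_self_antitoneOn hlog (hlog.trans hlogmono) hlogmono)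
    (Real.log_div_self_antitoneOn hm (hm.trans hmi) hmi)
    (div_nonneg (hlog0.le.trans hlogmono) (Nat.cast_nonneg _)) (by positivity)

theorem log_rpow_mul_lilScale_isBigO (s : ℝ) {q : ℝ} (hq : q < 1 / 2) :
    (fun m : ℕ => Real.log m ^ s * lilScale m) =O[atTop] fun m : ℕ => (m : ℝ) ^ (-q) := by
  have hlog : (fun m : ℕ => Real.log m ^ (s + 1 / 2)) =O[atTop]
      fun m : ℕ => (m : ℝ) ^ (1 / 2 - q) :=
    ((isLittleO_log_rpow_rpow_atTop (s + 1 / 2) (sub_pos.2 hq)).comp_tendsto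
      tendsto_natCast_atTop_atTop).isBigO
  have hmul := hlog.mul (isBigO_refl (fun m : ℕ => (m : ℝ) ^ (-(1 / 2) : ℝ)) atTop)
  refine (IsBigO.of_bound 1 ?_).trans (hmul.congr' EventuallyEq.rfl ?_)
  · filter_upwards [tendsto_log_natCast.eventually_ge_atTop 1] with m hm
    have hm0 : 0 < Real.log m := by linarith
    rw [Real.rpow_add hm0, ← Real.sqrt_eq_rpow, lilScale_eq_mul_rpow, one_mul, ← mul_assoc]
    simp only [norm_mul]
    gcongr ?_ * ?_ * _
    rw [Real.norm_of_nonneg (Real.sqrt_nonneg _), Real.norm_of_nonneg (Real.sqrt_nonneg _)]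
    exact Real.sqrt_le_sqrt (Real.log_le_self hm0.le)
  · filter_upwards [eventually_gt_atTop 0] with m hm
    rw [← Real.rpow_add (Nat.cast_pos.2 hm)]
    ring_nf

theorem lilScale_isBigO {q : ℝ} (hq : q < 1 / 2) :
    lilScale =O[atTop] fun m : ℕ => (m : ℝ) ^ (-q) := by
  simpa using log_rpow_mul_lilScale_isBigO 0 hq

end DecayRate

section WindowRecursion

theorem isBigO_of_window_supersolution {N : ℕ} {x g a b : ℕ → ℝ} {K : ℝ} (hN : 0 < N)
    (hx : ∀ m, 0 ≤ x m) (hg : ∀ᶠ m in atTop, 0 < g m) (ha : ∀ᶠ m in atTop, 0 ≤ a m)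
    (hb : ∀ᶠ m in atTop, 0 ≤ b m) (hxa : ∀ᶠ m in atTop, x (m + N) ≤ a m * x m + K * b m)
    (hga : ∀ᶠ m in atTop, a m * g m + b m ≤ g (m + N)) : x =O[atTop] g := by
  obtain ⟨m₀, hm₀⟩ := eventually_atTop.1 (hg.and (ha.and (hb.and (hxa.and hga))))
  set K' : ℝ := max K (∑ i ∈ Finset.range N, x (m₀ + i) / g (m₀ + i))
  have hle : ∀ m ≥ m₀, x m ≤ K' * g m := by
    intro m hm
    induction m using Nat.strong_induction_on with
    | _ m ih =>
      rcases lt_or_ge m (m₀ + N) with hlt | hge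
      · obtain ⟨i, rfl⟩ := Nat.exists_eq_add_of_le hm
        rw [← div_le_iff₀ (hm₀ _ hm).1]
        refine (Finset.single_le_sum (f := fun i => x (m₀ + i) / g (m₀ + i)) (fun j _ => ?_)
          (Finset.mem_range.2 (Nat.add_lt_add_iff_left.1 hlt))).trans (le_max_right _ _)
        exact div_nonneg (hx _) (hm₀ _ (Nat.le_add_right _ _)).1.le
      · obtain ⟨k, rfl⟩ := Nat.exists_eq_add_of_le' ((Nat.le_add_left N m₀).trans hge)
        have hk : m₀ ≤ k := Nat.add_le_add_iff_right.1 hge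
        obtain ⟨-, hak, hbk, hxk, hgk⟩ := hm₀ k hk
        calc x (k + N) ≤ a k * x k + K * b k := hxk
          _ ≤ a k * (K' * g k) + K' * b k := by
            gcongr
            · exact ih k (Nat.lt_add_of_pos_right hN) hk
            · exact le_max_left _ _
          _ = K' * (a k * g k + b k) := by ring
          _ ≤ K' * g (k + N) := by
            have hK0 : 0 ≤ K' := le_max_of_le_right (Finset.sum_nonneg fun j _ =>
              div_nonneg (hx _) (hm₀ _ (Nat.le_add_right _ _)).1.le)
            gcongr
  refine IsBigO.of_bound K' (eventually_atTop.2 ⟨m₀, fun m hm => ?_⟩)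
  rw [Real.norm_of_nonneg (hx m), Real.norm_of_nonneg (hm₀ m hm).1.le]
  exact hle m hm

/-- Over each window of length `N` the nonnegative sequence `x` contracts by the factor
`1 - N η m / m`, up to a relative error `O(1 / m ^ 2)` and a forcing term `O(h m / m)`. -/
structure WindowRecursion (N : ℕ) (x η h : ℕ → ℝ) : Prop where
  window_pos : 0 < N
  nonneg : ∀ m, 0 ≤ x m
  step : ∃ c, 0 ≤ c ∧ ∀ᶠ m : ℕ in atTop, 0 ≤ 1 - N * η m / m + c / (m : ℝ) ^ 2 ∧
    x (m + N) ≤ (1 - N * η m / m + c / (m : ℝ) ^ 2) * x m + c * (h m / m)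

/-- If the contraction beats the decay rate of `g` by the margin `τ`, then `g`, up to a constant,
is a supersolution of the recursion: half of the margin absorbs the relative error, the other half
the forcing term. -/
theorem WindowRecursion.isBigO {N : ℕ} {x η h g σ τ : ℕ → ℝ} (H : WindowRecursion N x η h)
    (hg : HasDecayRate N g σ) (hτ : ∀ᶠ m in atTop, 0 < τ m)
    (hrate : ∀ᶠ m in atTop, σ m + τ m ≤ η m) (hτinv : (fun m : ℕ => (m : ℝ)⁻¹) =o[atTop] τ)
    (hh : h =O[atTop] fun m => τ m * g m) : x =O[atTop] g := by
  have hN : (0 : ℝ) < N := Nat.cast_pos.2 H.window_pos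
  obtain ⟨c, hc, hstep⟩ := H.step
  obtain ⟨D, hD⟩ := hh.bound
  have hmargin : ∀ᶠ m : ℕ in atTop, c / (m : ℝ) ^ 2 ≤ N * τ m / (2 * m) := by
    filter_upwards [(hτinv.const_mul_left c).bound (half_pos hN), hτ, eventually_gt_atTop 0]
      with m hm hτm hm0
    have hm0 : (0 : ℝ) < m := Nat.cast_pos.2 hm0
    rw [Real.norm_of_nonneg hτm.le, Real.norm_of_nonneg (by positivity)] at hm
    calc c / (m : ℝ) ^ 2 = c * (m : ℝ)⁻¹ / m := by field_simp
      _ ≤ N / 2 * τ m / m := by gcongr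
      _ = N * τ m / (2 * m) := by field_simp
  refine isBigO_of_window_supersolution (K := 2 * c * D / N)
    (a := fun m => 1 - N * η m / m + c / (m : ℝ) ^ 2) (b := fun m => N * τ m / (2 * m) * g m)
    H.window_pos H.nonneg hg.eventually_pos (hstep.mono fun _ hm => hm.1) ?_ ?_ ?_
  · filter_upwards [hg.eventually_pos, hτ] with m hgm hτm
    positivity
  · filter_upwards [hstep, hD, hg.eventually_pos, hτ, eventually_gt_atTop 0]
      with m ⟨_, hm⟩ hDm hgm hτm hm0
    have hm0 : (0 : ℝ) < m := Nat.cast_pos.2 hm0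
    rw [Real.norm_of_nonneg (by positivity : 0 ≤ τ m * g m)] at hDm
    calc x (m + N) ≤ (1 - N * η m / m + c / (m : ℝ) ^ 2) * x m + c * (h m / m) := hm
      _ ≤ (1 - N * η m / m + c / (m : ℝ) ^ 2) * x m + c * (D * (τ m * g m) / m) := by
        gcongr
        exact (le_abs_self _).trans hDm
      _ = _ := by field_simp
  · filter_upwards [hg.eventually_mul_le, hmargin, hrate, hg.eventually_pos,
      eventually_gt_atTop 0] with m hm hcm hηm hgm hm0
    have hm0 : (0 : ℝ) < m := Nat.cast_pos.2 hm0
    refine le_trans ?_ hm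
    rw [← add_mul]
    gcongr
    have hη : N * (σ m + τ m) / m ≤ N * η m / m := by gcongr
    have hsplit : N * (σ m + τ m) / m = N * σ m / m + 2 * (N * τ m / (2 * m)) := by field_simp
    linarith

end WindowRecursion

section LinearRecursion

variable {E : Type*} [NormedAddCommGroup E]

theorem norm_sub_smul_le [InnerProductSpace ℝ E] {x s : E} {t κ Q : ℝ} (ht : 0 ≤ t)
    (htκ : t * κ ≤ 1)
    (hinner : κ * ‖x‖ ^ 2 ≤ inner ℝ x s) (hs : ‖s‖ ≤ Q * ‖x‖) :
    ‖x - t • s‖ ≤ (1 - t * κ + (t * Q) ^ 2) * ‖x‖ := by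
  have hs2 : ‖s‖ ^ 2 ≤ (Q * ‖x‖) ^ 2 := by gcongr
  refine le_of_sq_le_sq ?_ (mul_nonneg (by nlinarith) (norm_nonneg x))
  calc ‖x - t • s‖ ^ 2 = ‖x‖ ^ 2 - 2 * t * inner ℝ x s + t ^ 2 * ‖s‖ ^ 2 := by
        rw [norm_sub_sq_real, inner_smul_right, norm_smul, mul_pow, Real.norm_eq_abs, sq_abs]
        ring
    _ ≤ ‖x‖ ^ 2 - 2 * t * (κ * ‖x‖ ^ 2) + t ^ 2 * (Q * ‖x‖) ^ 2 := by gcongr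
    _ = (1 - 2 * (t * κ) + (t * Q) ^ 2) * ‖x‖ ^ 2 := by ring
    _ ≤ (1 - t * κ + (t * Q) ^ 2) ^ 2 * ‖x‖ ^ 2 := by
        gcongr
        nlinarith [sq_nonneg (t * κ - (t * Q) ^ 2), sq_nonneg (t * Q)]
    _ = _ := by ring

theorem inv_sub_inv_add_le {x y : ℝ} (hx : 0 < x) (hy : 0 ≤ y) :
    x⁻¹ - (x + y)⁻¹ ≤ y / x ^ 2 := by
  calc x⁻¹ - (x + y)⁻¹ = y / (x * (x + y)) := by field_simp; ring
    _ ≤ y / x ^ 2 := by rw [sq]; gcongr; linarith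

/-- A stochastic approximation recursion with steps `1 / (k + 1)`, linear mean fields `L k` of
norm at most `P` and disturbances `r k`. -/
structure LinearRecursion [NormedSpace ℝ E] (L : ℕ → E →L[ℝ] E) (r ψ : ℕ → E) (P : ℝ) : Prop where
  step : ∀ k, ψ (k + 1) = ψ k + ((k : ℝ) + 1)⁻¹ • (r k - L k (ψ k))
  norm_le : ∀ k, ‖L k‖ ≤ P

namespace LinearRecursion

section Window

variable [NormedSpace ℝ E] {L : ℕ → E →L[ℝ] E} {r ψ : ℕ → E} {P ρ : ℝ} {N m : ℕ}

theorem bound_nonneg (H : LinearRecursion L r ψ P) : 0 ≤ P := (norm_nonneg _).trans (H.norm_le 0)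

theorem norm_add_sub_le (H : LinearRecursion L r ψ P) (hm : 1 ≤ m)
    (hr : ∀ i < N, ‖r (m + i)‖ ≤ ρ) {i : ℕ} (hi : i ≤ N) :
    ‖ψ (m + i) - ψ m‖ ≤ ((2 + P) ^ i - 1) * ((‖ψ m‖ + ρ) / m) := by
  have hP := H.bound_nonneg
  have hm1 : (1 : ℝ) ≤ m := Nat.one_le_cast.2 hm
  induction i with
  | zero => simp
  | succ i ih =>
    have hρ : 0 ≤ ρ := (norm_nonneg _).trans (hr i hi)
    have hstep : ((m + i : ℕ) + 1 : ℝ)⁻¹ ≤ (m : ℝ)⁻¹ := by gcongr; push_cast; linarith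
    have hψ : ‖ψ (m + i)‖ ≤ ‖ψ m‖ + ‖ψ (m + i) - ψ m‖ := norm_le_norm_add_norm_sub' _ _
    have hdrift : ‖r (m + i) - L (m + i) (ψ (m + i))‖ ≤
        (1 + P) * (‖ψ m‖ + ρ) + (1 + P) * ‖ψ (m + i) - ψ m‖ :=
      calc _ ≤ ρ + P * (‖ψ m‖ + ‖ψ (m + i) - ψ m‖) := by
            refine (norm_sub_le _ _).trans (add_le_add (hr i hi) ?_)
            exact ((L _).le_of_opNorm_le (H.norm_le _) _).trans (by gcongr)
        _ ≤ _ := by nlinarith [norm_nonneg (ψ m), norm_nonneg (ψ (m + i) - ψ m), mul_nonneg hP hρ]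
    calc ‖ψ (m + (i + 1)) - ψ m‖
        = ‖(ψ (m + i) - ψ m) + ((m + i : ℕ) + 1 : ℝ)⁻¹ • (r (m + i) - L (m + i) (ψ (m + i)))‖ := by
          rw [← add_assoc, H.step]; congr 1; abel
      _ ≤ ‖ψ (m + i) - ψ m‖ +
          (m : ℝ)⁻¹ * ((1 + P) * (‖ψ m‖ + ρ) + (1 + P) * ‖ψ (m + i) - ψ m‖) := by
          refine (norm_add_le _ _).trans ?_
          rw [norm_smul, Real.norm_of_nonneg (by positivity)]
          gcongr
      _ ≤ (2 + P) * ‖ψ (m + i) - ψ m‖ + (1 + P) * ((‖ψ m‖ + ρ) / m) := by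
          have : (m : ℝ)⁻¹ * ((1 + P) * ‖ψ (m + i) - ψ m‖) ≤ 1 * ((1 + P) * ‖ψ (m + i) - ψ m‖) := by
            gcongr
            exact inv_le_one_of_one_le₀ hm1
          rw [mul_add, mul_left_comm (m : ℝ)⁻¹, ← div_eq_inv_mul]
          linarith
      _ ≤ (2 + P) * (((2 + P) ^ i - 1) * ((‖ψ m‖ + ρ) / m)) + (1 + P) * ((‖ψ m‖ + ρ) / m) := by
          gcongr
          exact ih (Nat.le_of_succ_le hi)
      _ = ((2 + P) ^ (i + 1) - 1) * ((‖ψ m‖ + ρ) / m) := by ring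

theorem norm_step_sub_le (H : LinearRecursion L r ψ P) (hm : 1 ≤ m)
    (hr : ∀ i < N, ‖r (m + i)‖ ≤ ρ) {i : ℕ} (hi : i < N) :
    ‖ψ (m + i + 1) - (ψ (m + i) - (m : ℝ)⁻¹ • L (m + i) (ψ m))‖ ≤
      (1 + N * P + P * (2 + P) ^ N) * (‖ψ m‖ / m ^ 2 + ρ / m) := by
  have hP := H.bound_nonneg
  have hm1 : (1 : ℝ) ≤ m := Nat.one_le_cast.2 hm
  have hρ : 0 ≤ ρ := (norm_nonneg _).trans (hr i hi)
  set t : ℝ := ((m + i : ℕ) + 1 : ℝ)⁻¹ with ht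
  have ht0 : 0 ≤ t := by positivity
  have htm : t ≤ (m : ℝ)⁻¹ := by rw [ht]; gcongr; push_cast; linarith
  have hgap : (m : ℝ)⁻¹ - t ≤ N / m ^ 2 := by
    have hiN : (i : ℝ) + 1 ≤ N := by exact_mod_cast hi
    calc (m : ℝ)⁻¹ - t = (m : ℝ)⁻¹ - (m + (i + 1) : ℝ)⁻¹ := by
          rw [ht, Nat.cast_add, add_assoc]
      _ ≤ (i + 1) / m ^ 2 := inv_sub_inv_add_le (by linarith) (by positivity)
      _ ≤ N / m ^ 2 := by gcongr
  have hdrift : ‖ψ (m + i) - ψ m‖ ≤ (2 + P) ^ N * ((‖ψ m‖ + ρ) / m) := by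
    refine (H.norm_add_sub_le hm hr hi.le).trans ?_
    gcongr
    linarith [pow_le_pow_right₀ (by linarith : 1 ≤ 2 + P) hi.le]
  calc _ = ‖t • r (m + i) + ((m : ℝ)⁻¹ - t) • L (m + i) (ψ m)
        - t • L (m + i) (ψ (m + i) - ψ m)‖ := by
        rw [H.step (m + i), map_sub, ← ht]; congr 1; module
    _ ≤ t * ‖r (m + i)‖ + ((m : ℝ)⁻¹ - t) * ‖L (m + i) (ψ m)‖
        + t * ‖L (m + i) (ψ (m + i) - ψ m)‖ := by
        refine (norm_sub_le _ _).trans (add_le_add ((norm_add_le _ _).trans_eq ?_) ?_)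
        · rw [norm_smul, norm_smul, Real.norm_of_nonneg ht0, Real.norm_of_nonneg (sub_nonneg.2 htm)]
        · rw [norm_smul, Real.norm_of_nonneg ht0]
    _ ≤ (m : ℝ)⁻¹ * ρ + N / m ^ 2 * (P * ‖ψ m‖)
        + (m : ℝ)⁻¹ * (P * ((2 + P) ^ N * ((‖ψ m‖ + ρ) / m))) := by
        gcongr
        · exact hr i hi
        · exact (L _).le_of_opNorm_le (H.norm_le _) _
        · exact ((L _).le_of_opNorm_le (H.norm_le _) _).trans (by gcongr)
    _ = ρ / m + N * P * (‖ψ m‖ / m ^ 2) + P * (2 + P) ^ N * (‖ψ m‖ / m ^ 2 + ρ / m ^ 2) := by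
        field_simp
    _ ≤ _ := by
        have hρm : ρ / (m : ℝ) ^ 2 ≤ ρ / m := by gcongr; exact le_self_pow₀ hm1 two_ne_zero
        have h1 : 0 ≤ P * (2 + P) ^ N := by positivity
        have h2 : 0 ≤ ‖ψ m‖ / (m : ℝ) ^ 2 := by positivity
        have h3 : 0 ≤ N * P * (ρ / m) := by positivity
        nlinarith

theorem norm_window_sub_le (H : LinearRecursion L r ψ P) (hm : 1 ≤ m)
    (hr : ∀ i < N, ‖r (m + i)‖ ≤ ρ) :
    ‖ψ (m + N) - (ψ m - (m : ℝ)⁻¹ • ∑ i ∈ Finset.range N, L (m + i) (ψ m))‖ ≤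
      N * (1 + N * P + P * (2 + P) ^ N) * (‖ψ m‖ / m ^ 2 + ρ / m) := by
  have htel : ψ (m + N) - (ψ m - (m : ℝ)⁻¹ • ∑ i ∈ Finset.range N, L (m + i) (ψ m)) =
      ∑ i ∈ Finset.range N, (ψ (m + i + 1) - (ψ (m + i) - (m : ℝ)⁻¹ • L (m + i) (ψ m))) := by
    simp only [sub_sub_eq_add_sub, add_sub_right_comm _ _ (ψ (m + _)), Finset.sum_add_distrib,
      ← Finset.smul_sum]
    have hsum := Finset.sum_range_sub (fun i => ψ (m + i)) N
    simp only [← add_assoc, add_zero] at hsum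
    rw [hsum]
    abel
  rw [htel, mul_assoc, ← nsmul_eq_mul, ← Finset.card_range N, ← Finset.sum_const,
    Finset.card_range]
  exact norm_sum_le_of_le _ fun i hi => H.norm_step_sub_le hm hr (Finset.mem_range.1 hi)

end Window

variable [InnerProductSpace ℝ E]

theorem windowRecursion {L : ℕ → E →L[ℝ] E} {r ψ : ℕ → E} {P K B : ℝ} {N : ℕ} {κ h : ℕ → ℝ}
    (H : LinearRecursion L r ψ P) (hN : 0 < N) (hh : ∀ m, 0 ≤ h m)
    (hκ : ∀ᶠ m in atTop, κ m ≤ K)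
    (hL : ∀ᶠ m in atTop, ∀ v,
      N * κ m * ‖v‖ ^ 2 ≤ inner ℝ v (∑ i ∈ Finset.range N, L (m + i) v))
    (hr : ∀ᶠ m in atTop, ∀ i < N, ‖r (m + i)‖ ≤ B * h m) :
    WindowRecursion N (fun m => ‖ψ m‖) κ h := by
  have hP := H.bound_nonneg
  set G : ℝ := N * (1 + N * P + P * (2 + P) ^ N)
  have hG0 : 0 ≤ G := by positivity
  refine ⟨hN, fun _ => norm_nonneg _, (N * P) ^ 2 + G * (1 + |B|), by positivity, ?_⟩
  filter_upwards [hκ, hL, hr, eventually_ge_atTop 1,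
    tendsto_natCast_atTop_atTop.eventually_ge_atTop (N * K)] with m hκm hLm hrm hm hmK
  have hm0 : (0 : ℝ) < m := Nat.cast_pos.2 hm
  have hκ1 : (m : ℝ)⁻¹ * (N * κ m) ≤ 1 := by
    rw [inv_mul_le_one₀ hm0]
    exact le_trans (by gcongr) hmK
  have hbound : ‖∑ i ∈ Finset.range N, L (m + i) (ψ m)‖ ≤ N * P * ‖ψ m‖ := by
    rw [mul_assoc, ← nsmul_eq_mul, ← Finset.card_range N, ← Finset.sum_const, Finset.card_range]
    exact norm_sum_le_of_le _ fun i _ => (L _).le_of_opNorm_le (H.norm_le _) _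
  have hcontract := norm_sub_smul_le (inv_nonneg.2 hm0.le) hκ1 (hLm (ψ m)) hbound
  have hB : B * h m ≤ |B| * h m := mul_le_mul_of_nonneg_right (le_abs_self B) (hh m)
  have hsq : 0 ≤ G * |B| / (m : ℝ) ^ 2 := by positivity
  constructor
  · rw [inv_mul_eq_div] at hκ1
    exact add_nonneg (sub_nonneg.2 hκ1) (by positivity)
  · calc ‖ψ (m + N)‖
        ≤ (1 - (m : ℝ)⁻¹ * (N * κ m) + ((m : ℝ)⁻¹ * (N * P)) ^ 2) * ‖ψ m‖
          + G * (‖ψ m‖ / m ^ 2 + |B| * h m / m) := by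
          refine (norm_le_norm_add_norm_sub' _ _).trans (add_le_add hcontract ?_)
          exact (H.norm_window_sub_le hm hrm).trans (by gcongr)
      _ = (1 - N * κ m / m + ((N * P) ^ 2 + G) / m ^ 2) * ‖ψ m‖ + G * |B| * (h m / m) := by
          field_simp
          ring
      _ ≤ _ := by
          have hhm : 0 ≤ h m / m := div_nonneg (hh m) hm0.le
          gcongr
          · nlinarith [abs_nonneg B]
          · nlinarith [abs_nonneg B, sq_nonneg (N * P)]

end LinearRecursion

end LinearRecursion

section AveragedRecursion

theorem rpow_neg_isLittleO_inv_log_pow {γ : ℝ} (hγ : 0 < γ) (j : ℕ) :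
    (fun m : ℕ => (m : ℝ) ^ (-γ)) =o[atTop] fun m : ℕ => (Real.log m ^ j)⁻¹ := by
  have hlog := (isLittleO_log_rpow_rpow_atTop j hγ).comp_tendsto tendsto_natCast_atTop_atTop
  refine (hlog.inv_rev ?_).congr (fun m => ?_) fun m => ?_
  · filter_upwards [tendsto_log_natCast.eventually_gt_atTop 0] with m hm hzero
    exact absurd hzero (Real.rpow_pos_of_pos hm _).ne'
  · exact (Real.rpow_neg m.cast_nonneg γ).symm
  · simp only [Function.comp_apply, Real.rpow_natCast]

variable {E : Type*} [NormedAddCommGroup E] [InnerProductSpace ℝ E]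

/-- The recursion satisfied by the process with averaged observations: a linear stochastic
approximation with regressors `u` and gains `a`, driven by the averaged noise `T`. The index of
`u` and `a` is that of the update, one less than the index of the regressors in the system. -/
structure AveragedRecursion (u ψ T : ℕ → E) (a : ℕ → ℝ) (M A δ : ℝ) (N : ℕ) : Prop where
  step : ∀ k, ψ (k + 1) =
    ψ k + ((k : ℝ) + 1)⁻¹ • (T k - (a k * inner ℝ (u k) (ψ k + T k)) • u k)
  norm_le : ∀ k, ‖u k‖ ≤ M
  gain_nonneg : ∀ k, 0 ≤ a k
  gain_le : ∀ k, a k ≤ A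
  delta_pos : 0 < δ
  window_pos : 0 < N
  excitation : ∀ m v, N * δ * ‖v‖ ^ 2 ≤ ∑ i ∈ Finset.range N, inner ℝ (u (m + i)) v ^ 2
  noise : T =O[atTop] lilScale

namespace AveragedRecursion

open InnerProductSpace (rankOne)

variable {u ψ T : ℕ → E} {a α : ℕ → ℝ} {M A δ : ℝ} {N : ℕ}

theorem linearRecursion (H : AveragedRecursion u ψ T a M A δ N) :
    LinearRecursion (fun k => a k • rankOne ℝ (u k) (u k))
      (fun k => T k - (a k • rankOne ℝ (u k) (u k)) (T k)) ψ (A * M ^ 2) where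
  step k := by
    simp only [H.step k, smul_smul, inner_add_right, smul_apply,
      InnerProductSpace.rankOne_apply, mul_add, add_smul]
    abel_nf
  norm_le k := by
    have hA : 0 ≤ A := (H.gain_nonneg k).trans (H.gain_le k)
    rw [norm_smul, InnerProductSpace.norm_rankOne, Real.norm_of_nonneg (H.gain_nonneg k), ← sq]
    gcongr
    exacts [H.gain_le k, H.norm_le k]

theorem le_inner_sum_rankOne (H : AveragedRecursion u ψ T a M A δ N) {c : ℝ} {m : ℕ}
    (hc : ∀ i < N, c ≤ a (m + i)) (v : E) :
    N * (δ * c) * ‖v‖ ^ 2 ≤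
      inner ℝ v (∑ i ∈ Finset.range N, (a (m + i) • rankOne ℝ (u (m + i)) (u (m + i))) v) := by
  have hδ := H.delta_pos
  have hsum : inner ℝ v (∑ i ∈ Finset.range N,
      (a (m + i) • rankOne ℝ (u (m + i)) (u (m + i))) v) =
      ∑ i ∈ Finset.range N, a (m + i) * inner ℝ (u (m + i)) v ^ 2 := by
    rw [inner_sum]
    refine Finset.sum_congr rfl fun i _ => ?_
    rw [smul_apply, InnerProductSpace.rankOne_apply, inner_smul_right,
      inner_smul_right, real_inner_comm, sq]
  rw [hsum]
  rcases le_total 0 c with hc0 | hc0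
  · calc N * (δ * c) * ‖v‖ ^ 2 = c * (N * δ * ‖v‖ ^ 2) := by ring
      _ ≤ c * ∑ i ∈ Finset.range N, inner ℝ (u (m + i)) v ^ 2 := by gcongr; exact H.excitation m v
      _ ≤ _ := by
        rw [Finset.mul_sum]
        gcongr with i hi
        exact hc i (Finset.mem_range.1 hi)
  · calc N * (δ * c) * ‖v‖ ^ 2 ≤ 0 := mul_nonpos_of_nonpos_of_nonneg
          (mul_nonpos_of_nonneg_of_nonpos N.cast_nonneg (mul_nonpos_of_nonneg_of_nonpos hδ.le hc0))
          (sq_nonneg _)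
      _ ≤ _ := Finset.sum_nonneg fun i _ => mul_nonneg (H.gain_nonneg _) (sq_nonneg _)

theorem windowRecursion (H : AveragedRecursion u ψ T a M A δ N)
    (hα : ∀ᶠ m in atTop, ∀ i < N, α m ≤ a (m + i)) :
    WindowRecursion N (fun m => ‖ψ m‖) (fun m => δ * α m) lilScale := by
  have hlin := H.linearRecursion
  obtain ⟨B, hB, hTB⟩ := H.noise.exists_nonneg
  refine hlin.windowRecursion (K := δ * A) (B := (1 + A * M ^ 2) * B) H.window_pos lilScale_nonneg
    ?_ (hα.mono fun m hm => H.le_inner_sum_rankOne hm) ?_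
  · filter_upwards [hα] with m hm
    exact mul_le_mul_of_nonneg_left ((hm 0 H.window_pos).trans (H.gain_le _)) H.delta_pos.le
  · filter_upwards [eventually_forall_ge_atTop.2 hTB.bound, eventually_lilScale_add_le]
      with m hTm hlil i _
    have hP := hlin.bound_nonneg
    have hT : ‖T (m + i)‖ ≤ B * lilScale m := by
      refine (hTm _ (Nat.le_add_right m i)).trans ?_
      rw [Real.norm_of_nonneg (lilScale_nonneg _)]
      gcongr
      exact hlil i
    calc _ ≤ ‖T (m + i)‖ + A * M ^ 2 * ‖T (m + i)‖ :=
          (norm_sub_le _ _).trans (add_le_add_right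
            (ContinuousLinearMap.le_of_opNorm_le _ (hlin.norm_le _) _) _)
      _ = (1 + A * M ^ 2) * ‖T (m + i)‖ := by ring
      _ ≤ (1 + A * M ^ 2) * B * lilScale m := by rw [mul_assoc]; gcongr

theorem isBigO_of_hasDecayRate_lt (H : AveragedRecursion u ψ T a M A δ N) {α p : ℝ} {g : ℕ → ℝ}
    (hα : ∀ᶠ k in atTop, α ≤ a k) (hp : p < δ * α) (hg : HasDecayRate N g fun _ => p)
    (hT : lilScale =O[atTop] g) : ψ =O[atTop] g := by
  have hwin := H.windowRecursion (α := fun _ => α)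
    ((eventually_forall_ge_atTop.2 hα).mono fun m hm i _ => hm _ (Nat.le_add_right m i))
  have hτ : 0 < δ * α - p := sub_pos.2 hp
  refine (hwin.isBigO (τ := fun _ => δ * α - p) hg (Eventually.of_forall fun _ => hτ)
    (Eventually.of_forall fun _ => (add_sub_cancel _ _).le) ?_
    (hT.trans ((isBigO_refl g _).const_mul_right hτ.ne'))).of_norm_left
  exact (isLittleO_const_iff hτ.ne').2 tendsto_inv_atTop_nhds_zero_nat

theorem isBigO_lilScale (H : AveragedRecursion u ψ T a M A δ N) {α : ℝ}
    (hα : ∀ᶠ k in atTop, α ≤ a k) (hrate : 1 / 2 < δ * α) : ψ =O[atTop] lilScale :=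
  H.isBigO_of_hasDecayRate_lt hα hrate (hasDecayRate_lilScale N) (isBigO_refl _ _)

theorem isBigO_rpow_neg_of_lt (H : AveragedRecursion u ψ T a M A δ N) {α p : ℝ}
    (hα : ∀ᶠ k in atTop, α ≤ a k) (hp0 : 0 ≤ p) (hp : p < 1 / 2) (hrate : p < δ * α) :
    ψ =O[atTop] fun k : ℕ => (k : ℝ) ^ (-p) :=
  H.isBigO_of_hasDecayRate_lt hα hrate (HasDecayRate.rpow_neg hp0) (lilScale_isBigO hp)

/-- A gain that approaches its limit at a polynomial rate loses nothing against a comparison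
sequence whose decay rate stays below the limit by a power of `1 / log`. -/
theorem isBigO_of_hasDecayRate_sub (H : AveragedRecursion u ψ T a M A δ N) {α b γ : ℝ}
    {g : ℕ → ℝ} {j : ℕ} (hγ : 0 < γ) (hb : 0 ≤ b)
    (hα : ∀ᶠ k : ℕ in atTop, α - b * (k : ℝ) ^ (-γ) ≤ a k)
    (hg : HasDecayRate N g fun m => δ * α - 1 / (4 * Real.log m ^ j))
    (hT : lilScale =O[atTop] fun m => (Real.log m ^ j)⁻¹ * g m) : ψ =O[atTop] g := by
  have hwin := H.windowRecursion (α := fun m => α - b * (m : ℝ) ^ (-γ)) <| by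
    filter_upwards [eventually_forall_ge_atTop.2 hα, eventually_gt_atTop 0] with m hm hm0 i _
    refine le_trans ?_ (hm _ (Nat.le_add_right m i))
    have hpow : ((m + i : ℕ) : ℝ) ^ (-γ) ≤ (m : ℝ) ^ (-γ) :=
      Real.rpow_le_rpow_of_nonpos (Nat.cast_pos.2 hm0) (by simp) (neg_nonpos.2 hγ.le)
    gcongr
  refine (hwin.isBigO (τ := fun m => 8⁻¹ * (Real.log m ^ j)⁻¹) hg ?_ ?_ ?_ ?_).of_norm_left
  · filter_upwards [tendsto_log_natCast.eventually_gt_atTop 0] with m hm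
    positivity
  · filter_upwards [((rpow_neg_isLittleO_inv_log_pow hγ j).const_mul_left (δ * b)).bound
      (by norm_num : (0 : ℝ) < 8⁻¹), tendsto_log_natCast.eventually_gt_atTop 0] with m hm hlog
    rw [Real.norm_of_nonneg (by positivity : 0 ≤ (Real.log m ^ j)⁻¹)] at hm
    have hle := (le_abs_self _).trans hm
    have hsplit : 1 / (4 * Real.log m ^ j) = 2 * (8⁻¹ * (Real.log m ^ j)⁻¹) := by
      field_simp; norm_num
    rw [hsplit]
    linarith
  · refine IsLittleO.const_mul_right (by norm_num) ?_
    simpa only [Real.rpow_neg_one] using rpow_neg_isLittleO_inv_log_pow one_pos j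
  · simp only [mul_assoc]
    exact hT.trans ((isBigO_refl _ _).const_mul_right (by norm_num))

theorem isBigO_log_mul_lilScale (H : AveragedRecursion u ψ T a M A δ N) {α b γ : ℝ}
    (hγ : 0 < γ) (hb : 0 ≤ b) (hα : ∀ᶠ k : ℕ in atTop, α - b * (k : ℝ) ^ (-γ) ≤ a k)
    (hrate : δ * α = 1 / 2) : ψ =O[atTop] fun k : ℕ => Real.log k * lilScale k := by
  refine H.isBigO_of_hasDecayRate_sub (j := 1) hγ hb hα ?_ ?_
  · simpa only [pow_one, hrate, neg_add_eq_sub] using HasDecayRate.log.mul (hasDecayRate_lilScale N)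
  · refine (isBigO_refl _ _).congr' ?_ EventuallyEq.rfl
    filter_upwards [tendsto_log_natCast.eventually_gt_atTop 0] with m hm
    rw [pow_one, inv_mul_cancel_left₀ hm.ne']

/-- The factor `exp (-1 / log m)`, which tends to one, lowers the decay rate of `m ^ (-δα)` just
enough to leave a margin. -/
theorem isBigO_rpow_neg (H : AveragedRecursion u ψ T a M A δ N) {α b γ : ℝ}
    (hγ : 0 < γ) (hb : 0 ≤ b) (hα : ∀ᶠ k : ℕ in atTop, α - b * (k : ℝ) ^ (-γ) ≤ a k)
    (hrate0 : 0 ≤ δ * α) (hrate : δ * α < 1 / 2) :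
    ψ =O[atTop] fun k : ℕ => (k : ℝ) ^ (-(δ * α)) := by
  have hexp : (fun m : ℕ => Real.exp (-(Real.log m)⁻¹)) =Θ[atTop] fun _ => (1 : ℝ) := by
    refine (isTheta_of_div_tendsto_nhds_ne_zero (c := 1) ?_ one_ne_zero).symm
    simpa using (tendsto_inv_atTop_zero.comp tendsto_log_natCast).neg.rexp
  have hψ : ψ =O[atTop] fun m : ℕ => (m : ℝ) ^ (-(δ * α)) * Real.exp (-(Real.log m)⁻¹) := by
    refine H.isBigO_of_hasDecayRate_sub (j := 2) hγ hb hα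
      ((HasDecayRate.rpow_neg hrate0).mul HasDecayRate.exp_neg_inv_log) ?_
    refine ((isBigO_refl (fun m : ℕ => (Real.log m ^ 2)⁻¹) atTop).mul
      ((log_rpow_mul_lilScale_isBigO 2 hrate).mul hexp.2)).congr' ?_ EventuallyEq.rfl
    filter_upwards [tendsto_log_natCast.eventually_gt_atTop 0] with m hm
    rw [mul_one, Real.rpow_two, inv_mul_cancel_left₀ (pow_ne_zero 2 hm.ne')]
  simpa only [mul_one] using hψ.trans ((isBigO_refl _ _).mul hexp.1)

theorem tendsto_zero (H : AveragedRecursion u ψ T a M A δ N) {c : ℝ} (hc : 0 < c)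
    (hgain : ∀ᶠ k : ℕ in atTop, c / Real.log k ≤ a k) : Tendsto ψ atTop (𝓝 0) := by
  have hδ := H.delta_pos
  have hwin := H.windowRecursion (α := fun m => c / (2 * Real.log m)) <| by
    filter_upwards [eventually_forall_ge_atTop.2 hgain, eventually_pos_le_one_le_log N]
      with m hm ⟨hm0, hNm, hlog⟩ i hi
    refine le_trans ?_ (hm _ (Nat.le_add_right m i))
    have hlogmono : Real.log m ≤ Real.log (m + i : ℕ) := Real.log_le_log hm0 (by simp)
    have hlogi : Real.log (m + i : ℕ) ≤ 2 * Real.log m := by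
      have hgap := log_add_sub_log_le hm0 (Nat.cast_nonneg (α := ℝ) i)
      have him : (i : ℝ) / m ≤ 1 :=
        div_le_one_of_le₀ ((Nat.cast_le.2 hi.le).trans hNm) hm0.le
      push_cast
      linarith
    gcongr
    linarith
  set κ : ℝ := δ * c / 4 with hκ
  have hκ0 : 0 < κ := by positivity
  have hψ : (fun m => ‖ψ m‖) =O[atTop] fun m : ℕ => Real.log m ^ (-κ) := by
    refine hwin.isBigO (τ := fun m => κ / Real.log m) (HasDecayRate.log_rpow_neg hκ0.le) ?_ ?_ ?_ ?_
    · filter_upwards [tendsto_log_natCast.eventually_gt_atTop 0] with m hm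
      positivity
    · refine Eventually.of_forall fun m => le_of_eq ?_
      rw [hκ]
      ring
    · simpa only [pow_one, Real.rpow_neg_one, div_eq_mul_inv] using
        (rpow_neg_isLittleO_inv_log_pow one_pos 1).const_mul_right hκ0.ne'
    · have hlil := (isBigO_refl (fun m : ℕ => Real.log m ^ (-(κ + 1))) atTop).mul
        (log_rpow_mul_lilScale_isBigO (κ + 1) one_half_pos)
      refine (hlil.congr' ?_ ?_).trans (isBigO_const_mul_self κ⁻¹ _ _)
      · filter_upwards [tendsto_log_natCast.eventually_gt_atTop 0] with m hm
        rw [← mul_assoc, ← Real.rpow_add hm, neg_add_cancel, Real.rpow_zero, one_mul]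
      · filter_upwards [tendsto_log_natCast.eventually_gt_atTop 0] with m hm
        rw [neg_zero, Real.rpow_zero, mul_one, neg_add, Real.rpow_add hm, Real.rpow_neg_one]
        field_simp
  exact tendsto_zero_iff_norm_tendsto_zero.2 (hψ.trans_tendsto
    ((tendsto_rpow_neg_atTop hκ0).comp tendsto_log_natCast))

end AveragedRecursion

end AveragedRecursion

section SecantSlope

/-- The slope `(F w - F z) / (w - z)` of the secant of `F`, with the value `κ` at `w = z`: whatever
the derivative of `F` there, a lower bound of `κ` and of the proper secants is then a lower bound
of `secantSlope F κ z`. -/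
noncomputable def secantSlope (F : ℝ → ℝ) (κ z : ℝ) : ℝ → ℝ := Function.update (slope F z) z κ

variable {F : ℝ → ℝ} {c κ z w : ℝ}

theorem secantSlope_self : secantSlope F κ z z = κ := Function.update_self ..

theorem secantSlope_of_ne (h : w ≠ z) : secantSlope F κ z w = (F w - F z) / (w - z) := by
  rw [secantSlope, Function.update_of_ne h, slope_def_field]

theorem secantSlope_mul_sub (F : ℝ → ℝ) (κ z w : ℝ) :
    secantSlope F κ z w * (w - z) = F w - F z := by
  rcases eq_or_ne w z with rfl | h
  · simp only [sub_self, mul_zero]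
  · rw [secantSlope_of_ne h, div_mul_cancel₀ _ (sub_ne_zero.2 h)]

theorem le_secantSlope {s : Set ℝ} (hF : MonotoneOn (fun x => F x - c * x) s) (hκ : c ≤ κ)
    (hz : z ∈ s) (hw : w ∈ s) : c ≤ secantSlope F κ z w := by
  rcases eq_or_ne w z with rfl | h
  · rwa [secantSlope_self]
  · have hslope := hF.slope_nonneg hz hw
    rw [slope_def_field] at hslope
    rw [secantSlope_of_ne h, ← sub_nonneg]
    refine hslope.trans_eq ?_
    field_simp [sub_ne_zero.2 h]
    ring

theorem secantSlope_nonneg (hF : Monotone F) (hκ : 0 ≤ κ) : 0 ≤ secantSlope F κ z w :=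
  le_secantSlope (s := univ) (by simpa using hF.monotoneOn univ) hκ (mem_univ z) (mem_univ w)

theorem secantSlope_le {K : NNReal} (hF : LipschitzWith K F) :
    secantSlope F κ z w ≤ max κ K := by
  rcases eq_or_ne w z with rfl | h
  · rw [secantSlope_self]
    exact le_max_left _ _
  · rw [secantSlope_of_ne h]
    refine (le_abs_self _).trans (le_max_of_le_right ?_)
    rw [abs_div, div_le_iff₀ (abs_pos.2 (sub_ne_zero.2 h))]
    exact hF.norm_sub_le w z

theorem div_le_secantSlope (hF : Monotone F)
    (hFc : MonotoneOn (fun x => F x - c * x) (Icc (z - 1) (z + 1))) (hc : 0 ≤ c) (hκ : c ≤ κ) :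
    c / (1 + |w - z|) ≤ secantSlope F κ z w := by
  rcases le_or_gt |w - z| 1 with h | h
  · have hw := abs_le.1 h
    exact (div_le_self hc (le_add_of_nonneg_right (abs_nonneg _))).trans
      (le_secantSlope hFc hκ ⟨by linarith, by linarith⟩ ⟨by linarith, by linarith⟩)
  have hwz : w ≠ z := by
    rintro rfl
    norm_num at h
  have hincr : c ≤ |F w - F z| := by
    rcases lt_abs.1 h with hright | hleft
    · have hstep := hFc ⟨by linarith, by linarith⟩ ⟨by linarith, le_rfl⟩ (lt_add_one z).le
      have hrest := hF (by linarith : z + 1 ≤ w)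
      exact le_abs.2 (Or.inl (by linarith))
    · have hstep := hFc ⟨le_rfl, by linarith⟩ ⟨by linarith, by linarith⟩ (sub_one_lt z).le
      have hrest := hF (by linarith : w ≤ z - 1)
      exact le_abs.2 (Or.inr (by linarith))
  calc c / (1 + |w - z|) ≤ c / |w - z| := by gcongr; linarith
    _ ≤ |F w - F z| / |w - z| := by gcongr
    _ = secantSlope F κ z w := by
      rw [← abs_div, ← secantSlope_of_ne hwz, abs_of_nonneg (secantSlope_nonneg hF (hc.trans hκ))]

end SecantSlope

section Noise

theorem monotoneOn_cdf_sub_mul {ν : Measure ℝ} [IsProbabilityMeasure ν] {f : ℝ → ℝ} {c : ℝ}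
    {s : Set ℝ} (hν : ν = volume.withDensity fun x => ENNReal.ofReal (f x)) (hs : s.OrdConnected)
    (hc : ∀ t ∈ s, c ≤ f t) : MonotoneOn (fun x => cdf ν x - c * x) s := by
  intro x hx y hy hxy
  have hmass : ENNReal.ofReal (c * (y - x)) ≤ ENNReal.ofReal (cdf ν y - cdf ν x) := by
    calc ENNReal.ofReal (c * (y - x)) = ∫⁻ _ in Ioc x y, ENNReal.ofReal c := by
          rw [ENNReal.ofReal_mul' (sub_nonneg.2 hxy), setLIntegral_const, Real.volume_Ioc]
      _ ≤ ∫⁻ t in Ioc x y, ENNReal.ofReal (f t) :=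
          setLIntegral_mono' measurableSet_Ioc fun t ht =>
            ENNReal.ofReal_le_ofReal (hc t (hs.out hx hy (Ioc_subset_Icc_self ht)))
      _ = ENNReal.ofReal (cdf ν y - cdf ν x) := by
          rw [← withDensity_apply _ measurableSet_Ioc, ← hν, ← StieltjesFunction.measure_Ioc,
            measure_cdf]
  have hincr := (ENNReal.ofReal_le_ofReal_iff (sub_nonneg.2 (monotone_cdf ν hxy))).1 hmass
  dsimp only
  linarith

variable {Ω : Type*} [MeasurableSpace Ω] {μ : Measure Ω}

theorem hasSubgaussianMGF_cdf_sub_indicator [IsProbabilityMeasure μ] {ξ : Ω → ℝ}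
    (hξ : AEMeasurable ξ μ) (z : ℝ) {b B : ℝ} (hb : |b| ≤ B) :
    HasSubgaussianMGF (fun ω => b * (cdf (μ.map ξ) z - (Iic z).indicator 1 (ξ ω)))
      ((‖B - -B‖₊ / 2) ^ 2) μ := by
  have := Measure.isProbabilityMeasure_map hξ
  have hind : Measurable ((Iic z).indicator (1 : ℝ → ℝ)) :=
    measurable_one.indicator measurableSet_Iic
  have hmean : ∫ ω, (Iic z).indicator (1 : ℝ → ℝ) (ξ ω) ∂μ = cdf (μ.map ξ) z := by
    rw [← integral_map hξ hind.aestronglyMeasurable, integral_indicator_one measurableSet_Iic,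
      cdf_eq_real]
  have hmem : ∀ x, -b * (Iic z).indicator 1 x ∈ Icc (-B) B := fun x => by
    rw [mem_Icc, ← abs_le, abs_mul, abs_neg]
    refine (mul_le_of_le_one_right (abs_nonneg b) ?_).trans hb
    by_cases h : x ∈ Iic z <;> simp [h]
  refine (hasSubgaussianMGF_of_mem_Icc ((hind.comp_aemeasurable hξ).const_mul (-b))
    (Eventually.of_forall fun ω => hmem (ξ ω))).congr (Eventually.of_forall fun ω => ?_)
  simp only [Function.comp_apply, integral_const_mul, hmean]
  ring

theorem ae_sum_cdf_sub_indicator_smul_isBigO [IsProbabilityMeasure μ] {ι : Type*} [Fintype ι]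
    {ξ : ℕ → Ω → ℝ} {v : ℕ → EuclideanSpace ℝ ι} {B : ℝ} (hind : iIndepFun ξ μ)
    (hξ : ∀ i, AEMeasurable (ξ i) μ) (z : ℕ → ℝ) (hv : ∀ i, ‖v i‖ ≤ B) :
    ∀ᵐ ω ∂μ, (fun k : ℕ => ∑ i ∈ Finset.range k,
        (cdf (μ.map (ξ i)) (z i) - (Iic (z i)).indicator 1 (ξ i ω)) • v i) =O[atTop]
      fun k : ℕ => √(k * Real.log (Real.log k)) := by
  have hB : 0 ≤ B := (norm_nonneg _).trans (hv 0)
  have hcoord : ∀ j, ∀ᵐ ω ∂μ, (fun k : ℕ => ∑ i ∈ Finset.range k,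
      v i j * (cdf (μ.map (ξ i)) (z i) - (Iic (z i)).indicator 1 (ξ i ω))) =O[atTop]
        fun k : ℕ => √(k * Real.log (Real.log k)) := fun j => by
    have hvj : ∀ i, |v i j| ≤ B + 1 := fun i =>
      (PiLp.norm_apply_le (v i) j).trans ((hv i).trans (lt_add_one B).le)
    refine ae_sum_isBigO_sqrt_log_log (c := (‖B + 1 - -(B + 1)‖₊ / 2) ^ 2) ?_ ?_
      fun i => hasSubgaussianMGF_cdf_sub_indicator (hξ i) (z i) (hvj i)
    · exact hind.comp (fun i x => v i j * (cdf (μ.map (ξ i)) (z i) - (Iic (z i)).indicator 1 x))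
        fun i => ((measurable_one.indicator measurableSet_Iic).const_sub _).const_mul _
    · have hlen : B + 1 - -(B + 1) ≠ 0 := by linarith
      exact pow_pos (half_pos (nnnorm_pos.2 hlen)) 2
  filter_upwards [ae_all_iff.2 hcoord] with ω hω
  refine ((PiLp.continuousLinearEquiv 2 ℝ fun _ : ι => ℝ).symm.toContinuousLinearMap.isBigO_comp
    (fun k j => ∑ i ∈ Finset.range k,
      v i j * (cdf (μ.map (ξ i)) (z i) - (Iic (z i)).indicator 1 (ξ i ω))) _).congr_left
    (fun k => ?_) |>.trans (isBigO_pi.2 hω)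
  ext j
  simp [mul_comm]

variable {d : ℕ → Ω → ℝ} {f : ℝ → ℝ}

theorem abs_noiseCDF_sub_observation_le_one {n : ℕ} (φ : ℕ → EuclideanSpace ℝ (Fin n))
    (θ : EuclideanSpace ℝ (Fin n)) (C x : ℝ) (k : ℕ) (ω : Ω) :
    |noiseCDF μ d x - observation d φ θ C k ω| ≤ 1 := by
  have h0 : 0 ≤ noiseCDF μ d x := cdf_nonneg _ x
  have h1 : noiseCDF μ d x ≤ 1 := cdf_le_one _ x
  rw [observation, abs_le]
  split_ifs <;> constructor <;> linarith

theorem averagedNoise_eq_smul_sum {n : ℕ} (φ : ℕ → EuclideanSpace ℝ (Fin n))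
    (θ : EuclideanSpace ℝ (Fin n)) (C β : ℝ) (k : ℕ) (ω : Ω) :
    averagedNoise μ d φ θ C β k ω = (k : ℝ)⁻¹ • ∑ i ∈ Finset.range k,
      (noiseCDF μ d (C - inner ℝ (φ (i + 1)) θ) -
        (Iic (C - inner ℝ (φ (i + 1)) θ)).indicator 1 (d (i + 1) ω)) • β • φ (i + 1) := by
  rw [averagedNoise, one_div, ← Finset.Ico_succ_right_eq_Icc, Finset.sum_Ico_eq_sum_range]
  congr 1
  refine Finset.sum_congr (by simp) fun i _ => ?_
  rw [add_comm 1 i, mul_comm β, mul_smul]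
  simp only [observation, output, indicator, mem_Iic, Pi.one_apply, le_sub_iff_add_le']
  congr

/-- Independent, identically distributed noise `d k`, `k ≥ 1`, without moment conditions, whose
Lipschitz distribution function has the density `f`, bounded away from zero on bounded sets. -/
structure RegularNoise (μ : Measure Ω) (d : ℕ → Ω → ℝ) (f : ℝ → ℝ) : Prop where
  indep : iIndepFun (fun k : ℕ => d (k + 1)) μ
  identDistrib : ∀ k, 1 ≤ k → IdentDistrib (d k) (d 1) μ μ
  cdf_lipschitz : ∃ K, LipschitzWith K (noiseCDF μ d)
  density : μ.map (d 1) = volume.withDensity fun x => ENNReal.ofReal (f x)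
  density_pos : ∀ X : Set ℝ, Bornology.IsBounded X → ∃ c > 0, ∀ x ∈ X, c ≤ f x

theorem NoiseAssumption.regularNoise (hd : NoiseAssumption μ d f) : RegularNoise μ d f where
  indep := hd.indep
  identDistrib := hd.identDistrib
  cdf_lipschitz := hd.cdf_lipschitz
  density := hd.density
  density_pos X hX := by
    obtain ⟨r, hr⟩ := hX.subset_ball 0
    obtain ⟨c, hc, hcf⟩ := hd.density_pos _ Metric.isOpen_ball Metric.isBounded_ball
    exact ⟨c, hc, fun x hx => hcf x (hr hx)⟩

namespace RegularNoise

theorem density_nonneg (hd : RegularNoise μ d f) (t : ℝ) : 0 ≤ f t := by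
  obtain ⟨c, hc, hcf⟩ := hd.density_pos {t} Bornology.isBounded_singleton
  exact hc.le.trans (hcf t rfl)

theorem monotoneOn_noiseCDF_sub_mul [IsProbabilityMeasure μ] (hd : RegularNoise μ d f) {c : ℝ}
    {s : Set ℝ} (hs : s.OrdConnected) (hc : ∀ t ∈ s, c ≤ f t) :
    MonotoneOn (fun x => noiseCDF μ d x - c * x) s :=
  have := Measure.isProbabilityMeasure_map (hd.identDistrib 1 le_rfl).aemeasurable_fst
  monotoneOn_cdf_sub_mul hd.density hs hc

theorem averagedNoise_isBigO [IsProbabilityMeasure μ] (hd : RegularNoise μ d f) {n : ℕ}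
    {φ : ℕ → EuclideanSpace ℝ (Fin n)} {M : ℝ} (hφ : ∀ k, ‖φ (k + 1)‖ ≤ M)
    (θ : EuclideanSpace ℝ (Fin n)) (C β : ℝ) :
    ∀ᵐ ω ∂μ, (fun k => averagedNoise μ d φ θ C β k ω) =O[atTop] lilScale := by
  have hmap : ∀ i, μ.map (d (i + 1)) = μ.map (d 1) := fun i =>
    (hd.identDistrib (i + 1) (Nat.le_add_left 1 i)).map_eq
  have hv : ∀ i, ‖β • φ (i + 1)‖ ≤ |β| * M := fun i => by
    rw [norm_smul, Real.norm_eq_abs]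
    exact mul_le_mul_of_nonneg_left (hφ i) (abs_nonneg β)
  filter_upwards [ae_sum_cdf_sub_indicator_smul_isBigO hd.indep
    (fun i => (hd.identDistrib (i + 1) (Nat.le_add_left 1 i)).aemeasurable_fst)
    (fun i => C - inner ℝ (φ (i + 1)) θ) hv] with ω hω
  simp only [averagedNoise_eq_smul_sum]
  simp only [hmap] at hω
  refine ((isBigO_refl (fun k : ℕ => (k : ℝ)⁻¹) atTop).smul hω).congr' EventuallyEq.rfl ?_
  filter_upwards [eventually_gt_atTop 0] with k hk
  have hk0 : (0 : ℝ) < k := Nat.cast_pos.2 hk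
  rw [smul_eq_mul, lilScale, Real.sqrt_mul hk0.le, Real.sqrt_div' _ hk0.le, ← mul_assoc,
    inv_mul_eq_div, Real.sqrt_div_self, inv_mul_eq_div]

end RegularNoise

end Noise

section LowerDensity

variable {n : ℕ} {f : ℝ → ℝ} {C M : ℝ} {θ : EuclideanSpace ℝ (Fin n)}

theorem exists_gt_forall_lt_of_lt_lowerDensity (hf : ∀ t, 0 ≤ f t) (hM : 0 ≤ M) {c : ℝ}
    (hc : c < lowerDensity f C M θ 0) :
    ∃ R > M * ‖θ‖, ∀ t ∈ Icc (C - R) (C + R), c < f t := by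
  have hlim := tendsto_lowerDensity hf C hM θ le_rfl
  rw [add_zero] at hlim
  obtain ⟨R, hcR, hR⟩ := ((hlim.eventually_const_lt hc).and self_mem_nhdsWithin).exists
  refine ⟨R, hR, fun t ht => hcR.trans_le ?_⟩
  exact csInf_le ⟨0, forall_mem_image.2 fun u _ => hf u⟩ (mem_image_of_mem f ht)

theorem lowerDensity_le (hf : ∀ t, 0 ≤ f t) (hM : 0 ≤ M) {t : ℝ}
    (ht : t ∈ Icc (C - M * ‖θ‖) (C + M * ‖θ‖)) : lowerDensity f C M θ 0 ≤ f t := by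
  refine le_of_forall_lt fun c hc => ?_
  obtain ⟨R, hR, hcf⟩ := exists_gt_forall_lt_of_lt_lowerDensity hf hM hc
  exact hcf t ⟨by linarith [ht.1], by linarith [ht.2]⟩

theorem le_lowerDensity (hf : ∀ t, 0 ≤ f t) (hM : 0 ≤ M) {c R : ℝ} (hR : M * ‖θ‖ < R)
    (hc : ∀ t ∈ Icc (C - R) (C + R), c ≤ f t) : c ≤ lowerDensity f C M θ 0 := by
  have hlim := tendsto_lowerDensity hf C hM θ le_rfl
  rw [add_zero] at hlim
  have h0 : 0 ≤ M * ‖θ‖ := by positivity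
  refine ge_of_tendsto hlim ?_
  filter_upwards [Ioo_mem_nhdsGT hR] with z ⟨hz, hzR⟩
  have hne : (Icc (C - z) (C + z)).Nonempty := nonempty_Icc.2 (by linarith)
  refine le_csInf (hne.image f) (forall_mem_image.2 fun t ht => hc t ?_)
  exact ⟨by linarith [ht.1], by linarith [ht.2]⟩

theorem exists_lowerDensity_sub_mul_le (hf : ∀ t, 0 ≤ f t) (hM : 0 ≤ M)
    (hlip : LocallyLipschitz f) :
    ∃ L, 0 ≤ L ∧ ∀ s, 0 ≤ s → s ≤ 1 → ∀ t ∈ Icc (C - (M * ‖θ‖ + s)) (C + (M * ‖θ‖ + s)),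
      lowerDensity f C M θ 0 - L * s ≤ f t := by
  set R := M * ‖θ‖
  have hR0 : 0 ≤ R := by positivity
  obtain ⟨L, hL⟩ := hlip.locallyLipschitzOn.exists_lipschitzOnWith_of_compact
    (isCompact_Icc (a := C - (R + 1)) (b := C + (R + 1)))
  refine ⟨L, L.2, fun s hs0 hs1 t ht => ?_⟩
  have hCR : C - R ≤ C + R := by linarith
  set u : ℝ := (projIcc _ _ hCR t : ℝ) with hu
  have huI : u ∈ Icc (C - R) (C + R) := (projIcc _ _ hCR t).2
  have hut : |u - t| ≤ s := by
    rw [hu, coe_projIcc, abs_le]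
    rcases max_cases (C - R) (min (C + R) t) with h | h <;>
      rcases min_cases (C + R) t with h' | h' <;> constructor <;> linarith [ht.1, ht.2]
  have hlower := lowerDensity_le hf hM huI
  have hdiff := hL.norm_sub_le (x := u) ⟨by linarith [huI.1], by linarith [huI.2]⟩
    (y := t) ⟨by linarith [ht.1], by linarith [ht.2]⟩
  rw [Real.norm_eq_abs, Real.norm_eq_abs] at hdiff
  have hLs : L * |u - t| ≤ L * s := by gcongr
  linarith [le_abs_self (f u - f t)]

end LowerDensity

section Excitation

theorem abs_inner_le_mul {E : Type*} [NormedAddCommGroup E] [InnerProductSpace ℝ E] {x : E}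
    {M : ℝ} (hx : ‖x‖ ≤ M) (v : E) : |inner ℝ x v| ≤ M * ‖v‖ :=
  (abs_real_inner_le_norm x v).trans (mul_le_mul_of_nonneg_right hx (norm_nonneg v))

theorem dotProduct_sum_vecMulVec_mulVec {n : ℕ} (φ : ℕ → EuclideanSpace ℝ (Fin n)) (s : Finset ℕ)
    (v : EuclideanSpace ℝ (Fin n)) :
    v.ofLp ⬝ᵥ (∑ i ∈ s, Matrix.vecMulVec (φ i).ofLp (φ i).ofLp).mulVec v.ofLp =
      ∑ i ∈ s, inner ℝ (φ i) v ^ 2 := by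
  rw [Matrix.sum_mulVec, dotProduct_sum]
  refine Finset.sum_congr rfl fun i _ => ?_
  rw [EuclideanSpace.inner_eq_star_dotProduct, star_trivial, Matrix.vecMulVec_mulVec,
    dotProduct_smul, dotProduct_comm (φ i).ofLp v.ofLp, MulOpposite.smul_eq_mul_unop,
    MulOpposite.unop_op, sq]

namespace PersistentExcitation

variable {n : ℕ} {φ : ℕ → EuclideanSpace ℝ (Fin n)} {M δ : ℝ} {N : ℕ}

theorem norm_succ_le (hφ : PersistentExcitation φ M δ N) (k : ℕ) : ‖φ (k + 1)‖ ≤ M :=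
  hφ.bounded _ (Nat.le_add_left 1 k)

theorem bound_nonneg (hφ : PersistentExcitation φ M δ N) : 0 ≤ M :=
  (norm_nonneg _).trans (hφ.norm_succ_le 0)

theorem le_sum_inner_sq (hφ : PersistentExcitation φ M δ N) (m : ℕ)
    (v : EuclideanSpace ℝ (Fin n)) :
    N * δ * ‖v‖ ^ 2 ≤ ∑ i ∈ Finset.range N, inner ℝ (φ (m + i + 1)) v ^ 2 := by
  have hN : (0 : ℝ) < N := Nat.cast_pos.2 hφ.window_pos
  have hnorm : v.ofLp ⬝ᵥ v.ofLp = ‖v‖ ^ 2 := by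
    rw [← real_inner_self_eq_norm_sq, EuclideanSpace.inner_eq_star_dotProduct, star_trivial]
  have hpsd := (hφ.excitation (m + 1) (Nat.le_add_left 1 m)).dotProduct_mulVec_nonneg v.ofLp
  rw [star_trivial, Matrix.sub_mulVec, Matrix.smul_mulVec, Matrix.smul_mulVec, Matrix.one_mulVec,
    dotProduct_sub, dotProduct_smul, dotProduct_smul, dotProduct_sum_vecMulVec_mulVec, hnorm,
    smul_eq_mul, smul_eq_mul, sub_nonneg, one_div_mul_eq_div, le_div_iff₀ hN,
    Finset.sum_Ico_eq_sum_range, Nat.add_sub_cancel_left] at hpsd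
  simpa only [add_right_comm m 1, mul_comm (N : ℝ) δ, mul_right_comm δ] using hpsd

end PersistentExcitation

end Excitation

section ErrorRecursion

variable {Ω : Type*} [MeasurableSpace Ω] {μ : Measure Ω} {n : ℕ} {d : ℕ → Ω → ℝ} {f : ℝ → ℝ}
  {φ : ℕ → EuclideanSpace ℝ (Fin n)} {θ : EuclideanSpace ℝ (Fin n)} {C β M δ : ℝ} {N : ℕ}
  {θ₀ : Ω → EuclideanSpace ℝ (Fin n)} {c r κ : ℝ} {k : ℕ} {ω : Ω}

theorem natCast_smul_averagedNoise (k : ℕ) (ω : Ω) :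
    (k : ℝ) • averagedNoise μ d φ θ C β k ω = ∑ i ∈ Finset.Icc 1 k,
      (β * (noiseCDF μ d (C - inner ℝ (φ i) θ) - observation d φ θ C i ω)) • φ i := by
  rcases eq_or_ne (k : ℝ) 0 with h | h
  · obtain rfl : k = 0 := Nat.cast_eq_zero.1 h
    simp
  · rw [averagedNoise, one_div, smul_inv_smul₀ h]

theorem averagedNoise_succ (k : ℕ) (ω : Ω) :
    averagedNoise μ d φ θ C β (k + 1) ω = averagedNoise μ d φ θ C β k ω + ((k : ℝ) + 1)⁻¹ •
      ((β * (noiseCDF μ d (C - inner ℝ (φ (k + 1)) θ) - observation d φ θ C (k + 1) ω)) •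
        φ (k + 1) - averagedNoise μ d φ θ C β k ω) := by
  have hk : (k : ℝ) + 1 ≠ 0 := k.cast_add_one_ne_zero
  have hsum := natCast_smul_averagedNoise (μ := μ) (d := d) (φ := φ) (θ := θ) (C := C) (β := β)
    (k + 1) ω
  rw [Finset.sum_Icc_succ_top (Nat.le_add_left 1 k), ← natCast_smul_averagedNoise,
    Nat.cast_add_one, ← eq_inv_smul_iff₀ hk] at hsum
  rw [hsum]
  match_scalars <;> field_simp
  ring

theorem spao_add_averagedNoise (k : ℕ) (ω : Ω) :
    spao μ d φ θ C β θ₀ k ω + averagedNoise μ d φ θ C β k ω = estimate μ d φ θ C β θ₀ k ω - θ := by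
  rw [spao, sub_add_cancel]

/-- The gain which turns the update of the estimate into a linear one: the secant slope of the
noise distribution function between its arguments at `θ` and at the current estimate, times `β`.
The value `κ` of the secant slope on the diagonal does not affect the recursion. -/
noncomputable def gain (μ : Measure Ω) (d : ℕ → Ω → ℝ) (φ : ℕ → EuclideanSpace ℝ (Fin n))
    (θ : EuclideanSpace ℝ (Fin n)) (C β : ℝ) (θ₀ : Ω → EuclideanSpace ℝ (Fin n)) (κ : ℝ) (ω : Ω)
    (k : ℕ) : ℝ :=
  β * secantSlope (noiseCDF μ d) κ (C - inner ℝ (φ (k + 1)) θ)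
    (C - inner ℝ (φ (k + 1)) (estimate μ d φ θ C β θ₀ k ω))

theorem gain_mul_inner (κ : ℝ) (k : ℕ) (ω : Ω) :
    gain μ d φ θ C β θ₀ κ ω k * inner ℝ (φ (k + 1)) (estimate μ d φ θ C β θ₀ k ω - θ) =
      β * (noiseCDF μ d (C - inner ℝ (φ (k + 1)) θ) -
        noiseCDF μ d (C - inner ℝ (φ (k + 1)) (estimate μ d φ θ C β θ₀ k ω))) := by
  have hsecant := secantSlope_mul_sub (noiseCDF μ d) κ (C - inner ℝ (φ (k + 1)) θ)
    (C - inner ℝ (φ (k + 1)) (estimate μ d φ θ C β θ₀ k ω))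
  rw [gain, inner_sub_right]
  linear_combination -β * hsecant

theorem spao_succ (κ : ℝ) (k : ℕ) (ω : Ω) :
    spao μ d φ θ C β θ₀ (k + 1) ω = spao μ d φ θ C β θ₀ k ω + ((k : ℝ) + 1)⁻¹ •
      (averagedNoise μ d φ θ C β k ω - (gain μ d φ θ C β θ₀ κ ω k * inner ℝ (φ (k + 1))
        (spao μ d φ θ C β θ₀ k ω + averagedNoise μ d φ θ C β k ω)) • φ (k + 1)) := by
  rw [spao_add_averagedNoise, gain_mul_inner, spao, spao, averagedNoise_succ, estimate,
    Nat.cast_add_one, div_eq_mul_inv]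
  module

theorem norm_estimate_sub_le (hβ : 0 ≤ β) (hφ : PersistentExcitation φ M δ N) (hk : 1 ≤ k) :
    ‖estimate μ d φ θ C β θ₀ k ω - θ‖ ≤
      ‖estimate μ d φ θ C β θ₀ 1 ω - θ‖ + 2 * (β * M) * Real.log k := by
  induction k, hk using Nat.le_induction with
  | base => simp
  | succ k hk ih =>
    have hM := hφ.bound_nonneg
    have hk1 : (1 : ℝ) ≤ k := Nat.one_le_cast.2 hk
    have hlog := div_le_log_add_sub_log (zero_lt_one.trans_le hk1) zero_le_one hk1
    have hcoeff : |β / ((k + 1 : ℕ) : ℝ) *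
        (noiseCDF μ d (C - inner ℝ (φ (k + 1)) (estimate μ d φ θ C β θ₀ k ω)) -
          observation d φ θ C (k + 1) ω)| ≤ β / k := by
      rw [abs_mul, abs_of_nonneg (by positivity)]
      calc β / ((k + 1 : ℕ) : ℝ) * _ ≤ β / ((k + 1 : ℕ) : ℝ) * 1 := by
            gcongr
            exact abs_noiseCDF_sub_observation_le_one ..
        _ ≤ β / k := by
            rw [mul_one]
            gcongr
            exact Nat.le_succ k
    rw [estimate, add_sub_right_comm]
    refine (norm_add_le _ _).trans ?_
    calc _ ≤ ‖estimate μ d φ θ C β θ₀ 1 ω - θ‖ + 2 * (β * M) * Real.log k + β / k * M := by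
          rw [norm_smul, Real.norm_eq_abs]
          gcongr
          exact hφ.norm_succ_le k
      _ = ‖estimate μ d φ θ C β θ₀ 1 ω - θ‖ + 2 * (β * M) * (Real.log k + 1 / (2 * k)) := by ring
      _ ≤ _ := by
        rw [Nat.cast_add_one]
        gcongr
        linarith

end ErrorRecursion

section GainBounds

variable {Ω : Type*} [MeasurableSpace Ω] {μ : Measure Ω} {n : ℕ} {d : ℕ → Ω → ℝ} {f : ℝ → ℝ}
  {φ : ℕ → EuclideanSpace ℝ (Fin n)} {θ : EuclideanSpace ℝ (Fin n)} {C β M δ : ℝ} {N : ℕ}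
  {θ₀ : Ω → EuclideanSpace ℝ (Fin n)} {c r κ : ℝ} {k : ℕ} {ω : Ω}

theorem gain_nonneg (hβ : 0 ≤ β) (hκ : 0 ≤ κ) : 0 ≤ gain μ d φ θ C β θ₀ κ ω k :=
  mul_nonneg hβ (secantSlope_nonneg (monotone_cdf _) hκ)

theorem gain_le {K : NNReal} (hβ : 0 ≤ β) (hF : LipschitzWith K (noiseCDF μ d)) :
    gain μ d φ θ C β θ₀ κ ω k ≤ β * max κ K :=
  mul_le_mul_of_nonneg_left (secantSlope_le hF) hβ

variable [IsProbabilityMeasure μ]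

theorem le_gain (hβ : 0 ≤ β) (hφ : PersistentExcitation φ M δ N) (hd : RegularNoise μ d f)
    (hκ : c ≤ κ) (hr : M * ‖θ‖ + M * ‖estimate μ d φ θ C β θ₀ k ω - θ‖ ≤ r)
    (hc : ∀ t ∈ Icc (C - r) (C + r), c ≤ f t) : β * c ≤ gain μ d φ θ C β θ₀ κ ω k := by
  have hM := hφ.bound_nonneg
  have hθ := abs_le.1 (abs_inner_le_mul (hφ.norm_succ_le k) θ)
  have he := abs_le.1 (abs_inner_le_mul (hφ.norm_succ_le k) (estimate μ d φ θ C β θ₀ k ω - θ))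
  have he0 : 0 ≤ M * ‖estimate μ d φ θ C β θ₀ k ω - θ‖ := by positivity
  rw [inner_sub_right] at he
  exact mul_le_mul_of_nonneg_left (le_secantSlope (hd.monotoneOn_noiseCDF_sub_mul ordConnected_Icc
    hc) hκ ⟨by linarith, by linarith⟩ ⟨by linarith, by linarith⟩) hβ

theorem div_le_gain (hβ : 0 ≤ β) (hφ : PersistentExcitation φ M δ N) (hd : RegularNoise μ d f)
    (hc0 : 0 ≤ c) (hκ : c ≤ κ)
    (hc : ∀ t ∈ Icc (C - (M * ‖θ‖ + 1)) (C + (M * ‖θ‖ + 1)), c ≤ f t) :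
    β * c / (1 + M * ‖estimate μ d φ θ C β θ₀ k ω - θ‖) ≤ gain μ d φ θ C β θ₀ κ ω k := by
  have hθ := abs_le.1 (abs_inner_le_mul (hφ.norm_succ_le k) θ)
  have he : |C - inner ℝ (φ (k + 1)) (estimate μ d φ θ C β θ₀ k ω) -
      (C - inner ℝ (φ (k + 1)) θ)| ≤ M * ‖estimate μ d φ θ C β θ₀ k ω - θ‖ := by
    rw [sub_sub_sub_cancel_left, abs_sub_comm, ← inner_sub_right]
    exact abs_inner_le_mul (hφ.norm_succ_le k) _
  have hmono := hd.monotoneOn_noiseCDF_sub_mul ordConnected_Icc hc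
  rw [mul_div_assoc]
  refine mul_le_mul_of_nonneg_left (le_trans ?_ (div_le_secantSlope (monotone_cdf _)
    (hmono.mono (Icc_subset_Icc (by linarith) (by linarith))) hc0 hκ)) hβ
  gcongr

theorem exists_eventually_div_log_le_gain (hβ : 0 < β) (hφ : PersistentExcitation φ M δ N)
    (hd : RegularNoise μ d f) (ω : Ω) :
    ∃ c > 0, ∀ᶠ k : ℕ in atTop,
      c / Real.log k ≤ gain μ d φ θ C β θ₀ (lowerDensity f C M θ 0) ω k := by
  have hM := hφ.bound_nonneg
  obtain ⟨c, hc, hcf⟩ := hd.density_pos _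
    (Metric.isBounded_Icc (C - (M * ‖θ‖ + 1)) (C + (M * ‖θ‖ + 1)))
  have hcℓ := le_lowerDensity hd.density_nonneg hM (lt_add_one _) hcf
  set D := 1 + M * (‖estimate μ d φ θ C β θ₀ 1 ω - θ‖ + 2 * (β * M))
  have hD0 : 0 < D := by positivity
  refine ⟨β * c / D, by positivity, ?_⟩
  filter_upwards [eventually_ge_atTop 1, tendsto_log_natCast.eventually_ge_atTop 1] with k hk hlog
  refine le_trans ?_ (div_le_gain hβ.le hφ hd hc.le hcℓ hcf)
  rw [div_div]
  gcongr
  calc 1 + M * ‖estimate μ d φ θ C β θ₀ k ω - θ‖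
      ≤ 1 + M * (‖estimate μ d φ θ C β θ₀ 1 ω - θ‖ + 2 * (β * M) * Real.log k) := by
        gcongr
        exact norm_estimate_sub_le hβ.le hφ hk
    _ ≤ 1 * Real.log k + M * (‖estimate μ d φ θ C β θ₀ 1 ω - θ‖ * Real.log k +
          2 * (β * M) * Real.log k) := by
        gcongr
        · rwa [one_mul]
        · exact le_mul_of_one_le_right (norm_nonneg _) hlog
    _ = D * Real.log k := by ring

theorem exists_lt_mul_eventually_le_gain (hβ : 0 < β) (hφ : PersistentExcitation φ M δ N)
    (hd : RegularNoise μ d f)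
    (he : Tendsto (fun k => estimate μ d φ θ C β θ₀ k ω - θ) atTop (𝓝 0)) {p : ℝ}
    (hp : p < β * δ * lowerDensity f C M θ 0) :
    ∃ α, p < δ * α ∧
      ∀ᶠ k in atTop, α ≤ gain μ d φ θ C β θ₀ (lowerDensity f C M θ 0) ω k := by
  have hβδ : 0 < β * δ := mul_pos hβ hφ.delta_pos
  obtain ⟨c, hpc, hcℓ⟩ := exists_between ((div_lt_iff₀' hβδ).2 hp)
  obtain ⟨R, hR, hcf⟩ :=
    exists_gt_forall_lt_of_lt_lowerDensity hd.density_nonneg hφ.bound_nonneg hcℓ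
  refine ⟨β * c, ?_, ?_⟩
  · rw [div_lt_iff₀' hβδ] at hpc
    linarith
  · have hMe : Tendsto (fun k => M * ‖estimate μ d φ θ C β θ₀ k ω - θ‖) atTop (𝓝 0) := by
      simpa using he.norm.const_mul M
    filter_upwards [hMe.eventually_lt_const (sub_pos.2 hR)] with k hk
    exact le_gain hβ.le hφ hd hcℓ.le (by linarith) fun t ht => (hcf t ht).le

theorem exists_eventually_sub_rpow_le_gain (hβ : 0 ≤ β) (hφ : PersistentExcitation φ M δ N)
    (hd : RegularNoise μ d f) (hlip : LocallyLipschitz f) {γ : ℝ} (hγ : 0 < γ)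
    (he : (fun k => estimate μ d φ θ C β θ₀ k ω - θ) =O[atTop] fun k : ℕ => (k : ℝ) ^ (-γ)) :
    ∃ b, 0 ≤ b ∧ ∀ᶠ k : ℕ in atTop, β * lowerDensity f C M θ 0 - b * (k : ℝ) ^ (-γ) ≤
      gain μ d φ θ C β θ₀ (lowerDensity f C M θ 0) ω k := by
  have hM := hφ.bound_nonneg
  obtain ⟨L, hL0, hL⟩ := exists_lowerDensity_sub_mul_le (C := C) (θ := θ) hd.density_nonneg hM hlip
  obtain ⟨B, hB0, hB⟩ := he.exists_pos
  have hMe : Tendsto (fun k => M * ‖estimate μ d φ θ C β θ₀ k ω - θ‖) atTop (𝓝 0) := by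
    simpa using (he.trans_tendsto
      ((tendsto_rpow_neg_atTop hγ).comp tendsto_natCast_atTop_atTop)).norm.const_mul M
  refine ⟨β * (L * (M * B)), by positivity, ?_⟩
  filter_upwards [hB.bound, hMe.eventually_lt_const one_pos] with k hk hk1
  rw [Real.norm_of_nonneg (by positivity)] at hk
  set s := M * ‖estimate μ d φ θ C β θ₀ k ω - θ‖ with hs
  have hs0 : 0 ≤ s := by positivity
  calc β * lowerDensity f C M θ 0 - β * (L * (M * B)) * (k : ℝ) ^ (-γ)
      = β * (lowerDensity f C M θ 0 - L * (M * (B * (k : ℝ) ^ (-γ)))) := by ring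
    _ ≤ β * (lowerDensity f C M θ 0 - L * s) := by
      rw [hs]
      gcongr
    _ ≤ gain μ d φ θ C β θ₀ (lowerDensity f C M θ 0) ω k :=
      le_gain hβ hφ hd (sub_le_self _ (by positivity)) le_rfl (hL s hs0 hk1.le)

end GainBounds

section Rates

theorem isBigO_natCast_rpow_of_le {p q : ℝ} (h : p ≤ q) :
    (fun k : ℕ => (k : ℝ) ^ p) =O[atTop] fun k : ℕ => (k : ℝ) ^ q := by
  refine IsBigO.of_norm_eventuallyLE ?_
  filter_upwards [eventually_ge_atTop 1] with k hk
  rw [Real.norm_of_nonneg (by positivity)]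
  exact Real.rpow_le_rpow_of_exponent_le (Nat.one_le_cast.2 hk) h

variable {Ω : Type*} [MeasurableSpace Ω] {μ : Measure Ω} {n : ℕ}
  {d : ℕ → Ω → ℝ} {f : ℝ → ℝ} {φ : ℕ → EuclideanSpace ℝ (Fin n)} {θ : EuclideanSpace ℝ (Fin n)}
  {C β M δ : ℝ} {N : ℕ} {θ₀ : Ω → EuclideanSpace ℝ (Fin n)} {ω : Ω}

theorem RegularNoise.lowerDensity_pos (hd : RegularNoise μ d f) (hM : 0 ≤ M) :
    0 < lowerDensity f C M θ 0 := by
  obtain ⟨c, hc, hcf⟩ := hd.density_pos _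
    (Metric.isBounded_Icc (C - (M * ‖θ‖ + 1)) (C + (M * ‖θ‖ + 1)))
  exact hc.trans_le (le_lowerDensity hd.density_nonneg hM (lt_add_one _) hcf)

theorem exists_averagedRecursion (hβ : 0 ≤ β) (hφ : PersistentExcitation φ M δ N)
    (hd : RegularNoise μ d f)
    (hT : (fun k => averagedNoise μ d φ θ C β k ω) =O[atTop] lilScale) :
    ∃ A, AveragedRecursion (fun k => φ (k + 1)) (fun k => spao μ d φ θ C β θ₀ k ω)
      (fun k => averagedNoise μ d φ θ C β k ω)
      (gain μ d φ θ C β θ₀ (lowerDensity f C M θ 0) ω) M A δ N := by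
  obtain ⟨K, hK⟩ := hd.cdf_lipschitz
  exact ⟨β * max (lowerDensity f C M θ 0) K,
    { step := fun k => spao_succ _ k ω
      norm_le := hφ.norm_succ_le
      gain_nonneg := fun _ => gain_nonneg hβ (hd.lowerDensity_pos hφ.bound_nonneg).le
      gain_le := fun _ => gain_le hβ hK
      delta_pos := hφ.delta_pos
      window_pos := hφ.window_pos
      excitation := hφ.le_sum_inner_sq
      noise := hT }⟩

variable [IsProbabilityMeasure μ]

theorem tendsto_estimate_sub (hβ : 0 < β) (hφ : PersistentExcitation φ M δ N)
    (hd : RegularNoise μ d f)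
    (hT : (fun k => averagedNoise μ d φ θ C β k ω) =O[atTop] lilScale) :
    Tendsto (fun k => estimate μ d φ θ C β θ₀ k ω - θ) atTop (𝓝 0) := by
  obtain ⟨_, hrec⟩ := exists_averagedRecursion (θ₀ := θ₀) hβ.le hφ hd hT
  obtain ⟨c, hc, hgain⟩ := exists_eventually_div_log_le_gain (θ := θ) (θ₀ := θ₀) (C := C) hβ hφ hd ω
  have hnoise : Tendsto (fun k => averagedNoise μ d φ θ C β k ω) atTop (𝓝 0) :=
    (hT.trans (lilScale_isBigO (q := 1 / 4) (by norm_num))).trans_tendsto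
      ((tendsto_rpow_neg_atTop (by norm_num)).comp tendsto_natCast_atTop_atTop)
  simpa only [spao_add_averagedNoise, add_zero] using (hrec.tendsto_zero hc hgain).add hnoise

theorem spao_isBigO_lilScale (hβ : 0 < β) (hφ : PersistentExcitation φ M δ N)
    (hd : RegularNoise μ d f)
    (hT : (fun k => averagedNoise μ d φ θ C β k ω) =O[atTop] lilScale)
    (hη : 1 / 2 < β * δ * lowerDensity f C M θ 0) :
    (fun k => spao μ d φ θ C β θ₀ k ω) =O[atTop] lilScale := by
  obtain ⟨_, hrec⟩ := exists_averagedRecursion (θ₀ := θ₀) hβ.le hφ hd hT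
  obtain ⟨α, hrate, hα⟩ :=
    exists_lt_mul_eventually_le_gain hβ hφ hd (tendsto_estimate_sub hβ hφ hd hT) hη
  exact hrec.isBigO_lilScale hα hrate

theorem spao_isBigO_rpow_neg_of_lt (hβ : 0 < β) (hφ : PersistentExcitation φ M δ N)
    (hd : RegularNoise μ d f)
    (hT : (fun k => averagedNoise μ d φ θ C β k ω) =O[atTop] lilScale) {p : ℝ} (hp : p < 1 / 2)
    (hη : p < β * δ * lowerDensity f C M θ 0) :
    (fun k => spao μ d φ θ C β θ₀ k ω) =O[atTop] fun k : ℕ => (k : ℝ) ^ (-p) := by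
  obtain ⟨_, hrec⟩ := exists_averagedRecursion (θ₀ := θ₀) hβ.le hφ hd hT
  have hη0 : 0 < β * δ * lowerDensity f C M θ 0 :=
    mul_pos (mul_pos hβ hφ.delta_pos) (hd.lowerDensity_pos hφ.bound_nonneg)
  obtain ⟨α, hrate, hα⟩ := exists_lt_mul_eventually_le_gain hβ hφ hd
    (tendsto_estimate_sub (θ₀ := θ₀) hβ hφ hd hT) (max_lt hη hη0)
  refine (hrec.isBigO_rpow_neg_of_lt hα (le_max_right p 0) (max_lt hp one_half_pos) hrate).trans ?_
  exact isBigO_natCast_rpow_of_le (neg_le_neg (le_max_left p 0))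

theorem exists_eventually_sub_rpow_le_gain_of_averagedNoise (hβ : 0 < β)
    (hφ : PersistentExcitation φ M δ N) (hd : RegularNoise μ d f)
    (hT : (fun k => averagedNoise μ d φ θ C β k ω) =O[atTop] lilScale)
    (hlip : LocallyLipschitz f) :
    ∃ γ b : ℝ, 0 < γ ∧ 0 ≤ b ∧ ∀ᶠ k : ℕ in atTop,
      β * lowerDensity f C M θ 0 - b * (k : ℝ) ^ (-γ) ≤
        gain μ d φ θ C β θ₀ (lowerDensity f C M θ 0) ω k := by
  have hη0 : 0 < β * δ * lowerDensity f C M θ 0 :=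
    mul_pos (mul_pos hβ hφ.delta_pos) (hd.lowerDensity_pos hφ.bound_nonneg)
  obtain ⟨γ, hγ, hγmin⟩ := exists_between (lt_min hη0 (one_half_pos (α := ℝ)))
  have hγhalf : γ < 1 / 2 := hγmin.trans_le (min_le_right _ _)
  have herror := (spao_isBigO_rpow_neg_of_lt (θ₀ := θ₀) hβ hφ hd hT hγhalf
    (hγmin.trans_le (min_le_left _ _))).add (hT.trans (lilScale_isBigO hγhalf))
  simp only [spao_add_averagedNoise] at herror
  obtain ⟨b, hb, hgain⟩ := exists_eventually_sub_rpow_le_gain hβ.le hφ hd hlip hγ herror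
  exact ⟨γ, b, hγ, hb, hgain⟩

theorem spao_isBigO_log_mul_lilScale (hβ : 0 < β) (hφ : PersistentExcitation φ M δ N)
    (hd : RegularNoise μ d f)
    (hT : (fun k => averagedNoise μ d φ θ C β k ω) =O[atTop] lilScale)
    (hlip : LocallyLipschitz f) (hη : β * δ * lowerDensity f C M θ 0 = 1 / 2) :
    (fun k => spao μ d φ θ C β θ₀ k ω) =O[atTop] fun k : ℕ => Real.log k * lilScale k := by
  obtain ⟨_, hrec⟩ := exists_averagedRecursion (θ₀ := θ₀) hβ.le hφ hd hT
  obtain ⟨γ, b, hγ, hb, hα⟩ := exists_eventually_sub_rpow_le_gain_of_averagedNoise (θ₀ := θ₀)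
    hβ hφ hd hT hlip
  exact hrec.isBigO_log_mul_lilScale hγ hb hα (by linear_combination hη)

theorem spao_isBigO_rpow_neg (hβ : 0 < β) (hφ : PersistentExcitation φ M δ N)
    (hd : RegularNoise μ d f)
    (hT : (fun k => averagedNoise μ d φ θ C β k ω) =O[atTop] lilScale)
    (hlip : LocallyLipschitz f) (hη : β * δ * lowerDensity f C M θ 0 < 1 / 2) :
    (fun k => spao μ d φ θ C β θ₀ k ω) =O[atTop]
      fun k : ℕ => (k : ℝ) ^ (-(β * δ * lowerDensity f C M θ 0)) := by
  obtain ⟨_, hrec⟩ := exists_averagedRecursion (θ₀ := θ₀) hβ.le hφ hd hT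
  obtain ⟨γ, b, hγ, hb, hα⟩ := exists_eventually_sub_rpow_le_gain_of_averagedNoise (θ₀ := θ₀)
    hβ hφ hd hT hlip
  have hηeq : β * δ * lowerDensity f C M θ 0 = δ * (β * lowerDensity f C M θ 0) := by ring
  rw [hηeq] at hη ⊢
  have hℓ := hd.lowerDensity_pos (C := C) (θ := θ) hφ.bound_nonneg
  have hδ := hφ.delta_pos
  exact hrec.isBigO_rpow_neg hγ hb hα (by positivity) hη

end Rates

end SetValued

theorem theorem4_general {Ω : Type*} [MeasurableSpace Ω] (μ : Measure Ω) [IsProbabilityMeasure μ]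
    {n : ℕ} (d : ℕ → Ω → ℝ) (f : ℝ → ℝ)
    (φ : ℕ → EuclideanSpace ℝ (Fin n)) (θ : EuclideanSpace ℝ (Fin n))
    (C β M δ : ℝ) (N : ℕ) (θ₀ : Ω → EuclideanSpace ℝ (Fin n))
    (hβ : 0 < β)
    (hφ : SetValued.PersistentExcitation φ M δ N)
    (hd : SetValued.RegularNoise μ d f)
    (η : ℝ) (hη : η = β * δ * SetValued.lowerDensity f C M θ 0) :
    ((1 / 2 < η → ∀ᵐ ω ∂μ,
        (fun k : ℕ => SetValued.spao μ d φ θ C β θ₀ k ω) =O[atTop]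
          fun k : ℕ => Real.sqrt (Real.log (Real.log (k : ℝ)) / (k : ℝ))) ∧
      (η ≤ 1 / 2 → ∀ ε : ℝ, 0 < ε → ∀ᵐ ω ∂μ,
        (fun k : ℕ => SetValued.spao μ d φ θ C β θ₀ k ω) =O[atTop]
          fun k : ℕ => 1 / (k : ℝ) ^ (η - ε))) ∧
    (LocallyLipschitz f →
      (1 / 2 < η → ∀ᵐ ω ∂μ,
        (fun k : ℕ => SetValued.spao μ d φ θ C β θ₀ k ω) =O[atTop]
          fun k : ℕ => Real.sqrt (Real.log (Real.log (k : ℝ)) / (k : ℝ))) ∧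
      (η = 1 / 2 → ∀ᵐ ω ∂μ,
        (fun k : ℕ => SetValued.spao μ d φ θ C β θ₀ k ω) =O[atTop]
          fun k : ℕ => Real.log (k : ℝ) *
            Real.sqrt (Real.log (Real.log (k : ℝ)) / (k : ℝ))) ∧
      (η < 1 / 2 → ∀ᵐ ω ∂μ,
        (fun k : ℕ => SetValued.spao μ d φ θ C β θ₀ k ω) =O[atTop]
          fun k : ℕ => 1 / (k : ℝ) ^ η)) := by
  subst hη
  have hinv (p : ℝ) (k : ℕ) : 1 / (k : ℝ) ^ p = (k : ℝ) ^ (-p) := by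
    rw [Real.rpow_neg k.cast_nonneg, one_div]
  have hT := hd.averagedNoise_isBigO hφ.norm_succ_le θ C β
  simp only [hinv]
  refine ⟨⟨fun hη => hT.mono fun _ hω => ?_, fun hη ε hε => hT.mono fun _ hω => ?_⟩, fun hlip =>
    ⟨fun hη => hT.mono fun _ hω => ?_, fun hη => hT.mono fun _ hω => ?_,
      fun hη => hT.mono fun _ hω => ?_⟩⟩
  · exact SetValued.spao_isBigO_lilScale hβ hφ hd hω hη
  · exact SetValued.spao_isBigO_rpow_neg_of_lt hβ hφ hd hω (by linarith) (by linarith)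
  · exact SetValued.spao_isBigO_lilScale hβ hφ hd hω hη
  · exact SetValued.spao_isBigO_log_mul_lilScale hβ hφ hd hω hlip hη
  · exact SetValued.spao_isBigO_rpow_neg hβ hφ hd hω hlip hη

theorem theorem4 {Ω : Type*} [MeasurableSpace Ω] (μ : Measure Ω) [IsProbabilityMeasure μ]
    {n : ℕ} (d : ℕ → Ω → ℝ) (f : ℝ → ℝ)
    (φ : ℕ → EuclideanSpace ℝ (Fin n)) (θ : EuclideanSpace ℝ (Fin n))
    (C β M δ : ℝ) (N : ℕ) (θ₀ : Ω → EuclideanSpace ℝ (Fin n))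
    (hβ : 0 < β)
    (hφ : SetValued.PersistentExcitation φ M δ N)
    (hd : SetValued.NoiseAssumption μ d f)
    (η : ℝ) (hη : η = β * δ * SetValued.lowerDensity f C M θ 0) :
    ((1 / 2 < η → ∀ᵐ ω ∂μ,
        (fun k : ℕ => SetValued.spao μ d φ θ C β θ₀ k ω) =O[atTop]
          fun k : ℕ => Real.sqrt (Real.log (Real.log (k : ℝ)) / (k : ℝ))) ∧
      (η ≤ 1 / 2 → ∀ ε : ℝ, 0 < ε → ∀ᵐ ω ∂μ,
        (fun k : ℕ => SetValued.spao μ d φ θ C β θ₀ k ω) =O[atTop]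
          fun k : ℕ => 1 / (k : ℝ) ^ (η - ε))) ∧
    (LocallyLipschitz f →
      (1 / 2 < η → ∀ᵐ ω ∂μ,
        (fun k : ℕ => SetValued.spao μ d φ θ C β θ₀ k ω) =O[atTop]
          fun k : ℕ => Real.sqrt (Real.log (Real.log (k : ℝ)) / (k : ℝ))) ∧
      (η = 1 / 2 → ∀ᵐ ω ∂μ,
        (fun k : ℕ => SetValued.spao μ d φ θ C β θ₀ k ω) =O[atTop]
          fun k : ℕ => Real.log (k : ℝ) *
            Real.sqrt (Real.log (Real.log (k : ℝ)) / (k : ℝ))) ∧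
      (η < 1 / 2 → ∀ᵐ ω ∂μ,
        (fun k : ℕ => SetValued.spao μ d φ θ C β θ₀ k ω) =O[atTop]
          fun k : ℕ => 1 / (k : ℝ) ^ η)) :=
  theorem4_general μ d f φ θ C β M δ N θ₀ hβ hφ hd.regularNoise η hη
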